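/- Let $m \ge 2$ and $K \ge 1$ be integers, let $\Sigma = \{A_1,\dots,A_m\}$ be given by integer matrices $A_1,\dots,A_m \in \mathbb{Z}^{2\times 2}$, let $a \in \mathbb{Z}^2$, and let $f:\mathbb{R}^2 \to \mathbb{R}$ be a convex function that is accessed through a value oracle. Consider the following algorithm for finding $T_0,\dots,T_{K-1}\in\Sigma$ that maximize $f(T_{K-1}\cdots T_0a)$: start with $E_0=\{a\}$; for $k=0,1,\dots,K-1$ form the points of $\bigcup_{i=1}^m A_iE_k$ and let $E_{k+1}$ be the set of extreme points of their convex hull, computed by Graham's scan (find the lowest, leftmost point as pivot, sort the other points by polar angle around the pivot with an $O(l\log l)$ comparison sort such as merge sort, keep the farthest point at each angle, and scan with a stack); then find a maximizer $x^*$ of $f$ over $E_K$ by enumeration, and retrieve a matrix sequence $T_0,\dots,T_{K-1}$ that leads from $a$ to $x^*$ from the $m$-ary tree in which the points are stored. For $b\in\mathbb{R}^2$ let $N_k(\Sigma,b)$ be the number of extreme points of the convex hull of $\{T_{k-1}\cdots T_0b : T_0,\dots,T_{k-1}\in\Sigma\}$, and let $N_k(\Sigma)=\sup_{b\in\mathbb{R}^2}N_k(\Sigma,b)$.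 In the unit-cost model, in which every basic operation (arithmetic operation or comparison on integers, memory or control operation, call of the oracle, comparison of two oracle values) takes one step, the running time of this algorithm is $$O\Bigl(m\log m\sum_{k=0}^{K-1}N_k(\Sigma)+m\sum_{k=0}^{K-1}N_k(\Sigma)\log N_k(\Sigma)\Bigr),$$ that is, there is an absolute constant $C>0$ such that for all $m\ge 2$, $K\ge 1$, $A_1,\dots,A_m$, $a$ and $f$ as above the number of steps is at most $C$ times the expression in parentheses. -/

import Mathlib

/-! ## Switched linear systems and the quantities `N_k` -/

namespace SwitchedSystem

section Polytopes

variable {n : ℕ}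

/-- The trajectory `x(0) = a`, `x(k+1) = T_k x(k)` of the switched linear system. -/
def trajectory (T : ℕ → Matrix (Fin n) (Fin n) ℝ) (a : Fin n → ℝ) : ℕ → (Fin n → ℝ)
  | 0 => a
  | k + 1 => (T k).mulVec (trajectory T a k)

/-- `X_k(Σ, a)`: all vectors `T_{k-1} ⋯ T_0 a` with `T_0, …, T_{k-1} ∈ Σ`. -/
def reachable (S : Set (Matrix (Fin n) (Fin n) ℝ)) (a : Fin n → ℝ) (k : ℕ) : Set (Fin n → ℝ) :=
  {x | ∃ T : ℕ → Matrix (Fin n) (Fin n) ℝ, (∀ j < k, T j ∈ S) ∧ x = trajectory T a k}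

/-- `P_k(Σ, a)`, the convex hull of `X_k(Σ, a)`. -/
def polytope (S : Set (Matrix (Fin n) (Fin n) ℝ)) (a : Fin n → ℝ) (k : ℕ) : Set (Fin n → ℝ) :=
  convexHull ℝ (reachable S a k)

/-- `N_k(Σ, a)`, the number of extreme points of `P_k(Σ, a)`. -/
noncomputable def numExtremeAt (S : Set (Matrix (Fin n) (Fin n) ℝ)) (a : Fin n → ℝ) (k : ℕ) : ℕ :=
  ((polytope S a k).extremePoints ℝ).ncard

/-- `N_k(Σ) = sup_a N_k(Σ, a)`, the supremum over all real vectors `a`. For finite `Σ` it is a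
supremum of a bounded set of natural numbers, see `bddAbove_numExtremeAt`. -/
noncomputable def numExtreme (S : Set (Matrix (Fin n) (Fin n) ℝ)) (k : ℕ) : ℕ :=
  ⨆ a : Fin n → ℝ, numExtremeAt S a k

theorem reachable_zero (S : Set (Matrix (Fin n) (Fin n) ℝ)) (a : Fin n → ℝ) :
    reachable S a 0 = {a} := by
  ext x
  constructor
  · rintro ⟨T, -, rfl⟩
    rfl
  · rintro rfl
    exact ⟨fun _ => 0, fun j hj => absurd hj (Nat.not_lt_zero j), rfl⟩

theorem reachable_succ_subset (S : Set (Matrix (Fin n) (Fin n) ℝ)) (a : Fin n → ℝ) (k : ℕ) :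
    reachable S a (k + 1) ⊆ Set.image2 (fun T x => T.mulVec x) S (reachable S a k) := by
  rintro x ⟨T, hT, rfl⟩
  exact ⟨T k, hT k (Nat.lt_succ_self k), trajectory T a k,
    ⟨T, fun j hj => hT j (Nat.lt_succ_of_lt hj), rfl⟩, rfl⟩

theorem reachable_finite_ncard {S : Set (Matrix (Fin n) (Fin n) ℝ)} (hS : S.Finite)
    (a : Fin n → ℝ) (k : ℕ) :
    (reachable S a k).Finite ∧ (reachable S a k).ncard ≤ S.ncard ^ k := by
  induction k with
  | zero => simp [reachable_zero]
  | succ k ih =>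
    have hsub := reachable_succ_subset S a k
    have hfin : (Set.image2 (fun T x => T.mulVec x) S (reachable S a k)).Finite :=
      hS.image2 _ ih.1
    refine ⟨hfin.subset hsub, (Set.ncard_le_ncard hsub hfin).trans ?_⟩
    rw [← Set.image_uncurry_prod]
    refine (Set.ncard_image_le (hS.prod ih.1)).trans ?_
    rw [Set.ncard_prod, pow_succ, mul_comm]
    exact Nat.mul_le_mul_right _ ih.2

/-- For finite `Σ` the numbers `N_k(Σ, a)` are bounded in `a`, so that `numExtreme` is a
genuine supremum. -/
theorem bddAbove_numExtremeAt {S : Set (Matrix (Fin n) (Fin n) ℝ)} (hS : S.Finite) (k : ℕ) :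
    BddAbove (Set.range fun a : Fin n → ℝ => numExtremeAt S a k) := by
  refine ⟨S.ncard ^ k, ?_⟩
  rintro _ ⟨a, rfl⟩
  have h := reachable_finite_ncard hS a k
  exact (Set.ncard_le_ncard extremePoints_convexHull_subset h.1).trans h.2

end Polytopes

/-! ## The unit-cost machine model

A program manipulates integers and values of the objective function only through instructions.
The type `W` of machine words (integers) and the type `V` of oracle values are parameters of a
program: a program that is written for arbitrary `W` and `V` cannot compute with, compare or branch
on its data except by executing instructions. Every instruction costs one step. -/

/-- The arithmetic instructions. -/
inductive ArithOp
  | add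
  | sub
  | mul

/-- The comparison instructions. -/
inductive CmpOp
  | lt
  | le
  | eq

/-- Programs over words `W` and oracle values `V` that return an element of `α`. -/
inductive Prog (W V α : Type) : Type
  /-- Stop and return `x`. -/
  | ret (x : α)
  /-- An arithmetic operation on two words. -/
  | arith (op : ArithOp) (x y : W) (next : W → Prog W V α)
  /-- A comparison of two words. -/
  | cmp (op : CmpOp) (x y : W) (next : Bool → Prog W V α)
  /-- A query to the value oracle for the objective function at an integer point. -/
  | query (p : Fin 2 → W) (next : V → Prog W V α)
  /-- The comparison `u < v` of two values returned by the oracle. -/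
  | cmpVal (u v : V) (next : Bool → Prog W V α)
  /-- A memory or control instruction: reading or writing a list cell, entering a procedure or a
  loop iteration, updating a loop counter. -/
  | step (next : Prog W V α)

namespace Prog

variable {W V α β : Type}

/-- Run `p`, then run `g` on its result. -/
def bind : Prog W V α → (α → Prog W V β) → Prog W V β
  | ret x, g => g x
  | arith op x y k, g => arith op x y fun z => (k z).bind g
  | cmp op x y k, g => cmp op x y fun b => (k b).bind g
  | query p k, g => query p fun v => (k v).bind g
  | cmpVal u v k, g => cmpVal u v fun b => (k b).bind g
  | step k, g => step (k.bind g)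

instance : Monad (Prog W V) where
  pure := ret
  bind := bind

end Prog

/-- The meaning of the arithmetic instructions on integers. -/
def ArithOp.eval : ArithOp → ℤ → ℤ → ℤ
  | add, x, y => x + y
  | sub, x, y => x - y
  | mul, x, y => x * y

/-- The meaning of the comparison instructions on integers. -/
def CmpOp.eval : CmpOp → ℤ → ℤ → Bool
  | lt, x, y => decide (x < y)
  | le, x, y => decide (x ≤ y)
  | eq, x, y => decide (x = y)

namespace Prog

variable {α : Type}

open Classical in
/-- The result of running a program on integers with value oracle `f`. -/
noncomputable def value (f : (Fin 2 → ℝ) → ℝ) : Prog ℤ ℝ α → α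
  | ret x => x
  | arith op x y k => (k (op.eval x y)).value f
  | cmp op x y k => (k (op.eval x y)).value f
  | query p k => (k (f fun i => (p i : ℝ))).value f
  | cmpVal u v k => (k (decide (u < v))).value f
  | step k => k.value f

open Classical in
/-- The running time: the number of instructions executed when the program is run on integers with
value oracle `f`. -/
noncomputable def steps (f : (Fin 2 → ℝ) → ℝ) : Prog ℤ ℝ α → ℕ
  | ret _ => 0
  | arith op x y k => (k (op.eval x y)).steps f + 1
  | cmp op x y k => (k (op.eval x y)).steps f + 1
  | query p k => (k (f fun i => (p i : ℝ))).steps f + 1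
  | cmpVal u v k => (k (decide (u < v))).steps f + 1
  | step k => k.steps f + 1

end Prog

/-! ## The algorithm -/

section Algorithm

variable {W V α : Type}

/-- A memory or control instruction. -/
def tick : Prog W V Unit := .step (.ret ())

/-- An arithmetic instruction. -/
def arith (op : ArithOp) (x y : W) : Prog W V W := .arith op x y .ret

/-- A comparison instruction. -/
def cmp (op : CmpOp) (x y : W) : Prog W V Bool := .cmp op x y .ret

/-- A call of the value oracle. -/
def query (p : Fin 2 → W) : Prog W V V := .query p .ret

/-- A comparison of two values returned by the oracle. -/
def cmpVal (u v : V) : Prog W V Bool := .cmpVal u v .ret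

/-- Allocate one list cell. -/
def cons (x : α) (l : List α) : Prog W V (List α) := do
  tick
  return x :: l

/-- The length of a list, computed by traversing it. -/
def length : List α → Prog W V ℕ
  | [] => do
    tick
    return 0
  | _ :: l => do
    tick
    let c ← length l
    tick
    return c + 1

/-- `reverseOnto l acc` puts the entries of `l` one by one on top of `acc`. -/
def reverseOnto : List α → List α → Prog W V (List α)
  | [], acc => do
    tick
    return acc
  | x :: l, acc => do
    tick
    let acc' ← cons x acc
    reverseOnto l acc'

/-! ### Merge sort, with the comparison given as a program -/

/-- Merge two sorted lists. -/
def merge (le : α → α → Prog W V Bool) : List α → List α → Prog W V (List α)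
  | [], l => do
    tick
    return l
  | x :: l, [] => do
    tick
    return x :: l
  | x :: l, y :: l' => do
    tick
    if ← le x y then
      let r ← merge le l (y :: l')
      cons x r
    else
      let r ← merge le (x :: l) l'
      cons y r
termination_by l l' => l.length + l'.length

/-- Sort the first `c` entries of a list; return them sorted, together with the rest of the list. -/
def mergeSort (le : α → α → Prog W V Bool) : ℕ → List α → Prog W V (List α × List α)
  | 0, l => do
    tick
    return ([], l)
  | 1, [] => do
    tick
    return ([], [])
  | 1, x :: l => do
    tick
    let s ← cons x []
    return (s, l)
  | c + 2, l => do
    tick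
    tick -- the counter for the first half
    let (s₁, l₁) ← mergeSort le ((c + 2) / 2) l
    tick -- the counter for the second half
    let (s₂, l₂) ← mergeSort le ((c + 2) - (c + 2) / 2) l₁
    let s ← merge le s₁ s₂
    return (s, l₂)
termination_by c => c
decreasing_by all_goals omega

/-- A point of the plane that the algorithm has reached, with the matrices that lead to it from the
initial vector, the last one first. The lists of matrices share their tails: together they form
the `m`-ary tree in which the points are stored. -/
structure Node (W : Type) where
  point : Fin 2 → W
  path : List (Matrix (Fin 2) (Fin 2) W)

/-! ### Graham's scan -/

/-- Is `p` strictly lower than `q`, or equally low and strictly to its left? -/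
def lowerLeft (p q : Node W) : Prog W V Bool := do
  if ← cmp .lt (p.point 1) (q.point 1) then
    return true
  else if ← cmp .eq (p.point 1) (q.point 1) then
    cmp .lt (p.point 0) (q.point 0)
  else
    return false

/-- Do `p` and `q` have the same coordinates? -/
def samePoint (p q : Node W) : Prog W V Bool := do
  if ← cmp .eq (p.point 0) (q.point 0) then
    cmp .eq (p.point 1) (q.point 1)
  else
    return false

/-- The two products whose difference is the cross product of `p - o` and `q - o`. -/
def crossTerms (o p q : Node W) : Prog W V (W × W) := do
  let px ← arith .sub (p.point 0) (o.point 0)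
  let py ← arith .sub (p.point 1) (o.point 1)
  let qx ← arith .sub (q.point 0) (o.point 0)
  let qy ← arith .sub (q.point 1) (o.point 1)
  let s ← arith .mul px qy
  let t ← arith .mul py qx
  return (s, t)

/-- Does the path from `o` over `p` to `q` make a strict left turn at `p`? -/
def leftTurn (o p q : Node W) : Prog W V Bool := do
  let (s, t) ← crossTerms o p q
  cmp .lt t s

/-- Are `o`, `p`, `q` collinear? For `p`, `q` in the list sorted around the pivot `o` this means
that they are seen from `o` at the same polar angle. -/
def collinear (o p q : Node W) : Prog W V Bool := do
  let (s, t) ← crossTerms o p q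
  cmp .eq s t

/-- The squared distance of `p` from `o`. -/
def distSq (o p : Node W) : Prog W V W := do
  let dx ← arith .sub (p.point 0) (o.point 0)
  let dy ← arith .sub (p.point 1) (o.point 1)
  let dx2 ← arith .mul dx dx
  let dy2 ← arith .mul dy dy
  arith .add dx2 dy2

/-- The order by polar angle around the pivot `o`, at equal angles by distance from `o`. -/
def angleLe (o p q : Node W) : Prog W V Bool := do
  if ← leftTurn o p q then
    return true
  else if ← collinear o p q then
    let dp ← distSq o p
    let dq ← distSq o q
    cmp .le dp dq
  else
    return false

/-- The lowest point among `p` and the given list, the leftmost one in case of a tie. -/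
def findPivot : Node W → List (Node W) → Prog W V (Node W)
  | p, [] => do
    tick
    return p
  | p, q :: l => do
    tick
    if ← lowerLeft q p then
      findPivot q l
    else
      findPivot p l

/-- Remove all copies of the pivot `o`. -/
def removePivot (o : Node W) : List (Node W) → Prog W V (List (Node W))
  | [] => do
    tick
    return []
  | p :: l => do
    tick
    let r ← removePivot o l
    if ← samePoint p o then
      return r
    else
      cons p r

/-- In a list sorted by `angleLe o`, keep only the last, hence farthest, of the points at each
polar angle. -/
def keepFarthest (o : Node W) : List (Node W) → Prog W V (List (Node W))
  | [] => do
    tick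
    return []
  | [p] => do
    tick
    return [p]
  | p :: q :: l => do
    tick
    let r ← keepFarthest o (q :: l)
    if ← collinear o p q then
      return r
    else
      cons p r

/-- Pop the stack as long as its two topmost points and `p` do not make a strict left turn. -/
def popNonLeft (p : Node W) : List (Node W) → Prog W V (List (Node W))
  | [] => do
    tick
    return []
  | [t] => do
    tick
    return [t]
  | t :: u :: s => do
    tick
    if ← leftTurn u t p then
      return t :: u :: s
    else
      popNonLeft p (u :: s)

/-- The scan: each point in turn is pushed on the stack, after popping. -/
def scan : List (Node W) → List (Node W) → Prog W V (List (Node W))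
  | s, [] => do
    tick
    return s
  | s, p :: l => do
    tick
    let s' ← popNonLeft p s
    let s'' ← cons p s'
    scan s'' l

/-- Graham's scan: find the pivot, sort the other points by polar angle around it, keep the
farthest point at each angle, scan. Returns the extreme points of the convex hull. -/
def grahamScan : List (Node W) → Prog W V (List (Node W))
  | [] => do
    tick
    return []
  | p :: l => do
    tick
    let o ← findPivot p l
    let others ← removePivot o (p :: l)
    let c ← length others
    let (sorted, _) ← mergeSort (angleLe o) c others
    let rays ← keepFarthest o sorted
    let s ← cons o []
    scan s rays

/-! ### The forward dynamic programming algorithm in the plane -/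

/-- The product of a `2 × 2` matrix and a vector. -/
def applyMatrix (A : Matrix (Fin 2) (Fin 2) W) (p : Fin 2 → W) : Prog W V (Fin 2 → W) := do
  let u ← arith .mul (A 0 0) (p 0)
  let v ← arith .mul (A 0 1) (p 1)
  let x ← arith .add u v
  let u' ← arith .mul (A 1 0) (p 0)
  let v' ← arith .mul (A 1 1) (p 1)
  let y ← arith .add u' v'
  return ![x, y]

/-- Add the points of `A E` to the list `acc`. -/
def image (A : Matrix (Fin 2) (Fin 2) W) :
    List (Node W) → List (Node W) → Prog W V (List (Node W))
  | [], acc => do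
    tick
    return acc
  | e :: E, acc => do
    tick
    let p ← applyMatrix A e.point
    let path ← cons A e.path
    let acc' ← cons ⟨p, path⟩ acc
    image A E acc'

/-- Add the points of `A_i E`, for all matrices `A_i` in the list, to the list `acc`. -/
def images : List (Matrix (Fin 2) (Fin 2) W) → List (Node W) → List (Node W) →
    Prog W V (List (Node W))
  | [], _, acc => do
    tick
    return acc
  | A :: As, E, acc => do
    tick
    let acc' ← image A E acc
    images As E acc'

/-- The main loop, executed `K` times: replace `E_k` by the set `E_{k+1}` of extreme points of the
convex hull of the union of all `A_i E_k`. -/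
def mainLoop (As : List (Matrix (Fin 2) (Fin 2) W)) : ℕ → List (Node W) → Prog W V (List (Node W))
  | 0, E => do
    tick
    return E
  | K + 1, E => do
    tick
    let F ← images As E []
    let E' ← grahamScan F
    mainLoop As K E'

/-- Enumerate a list of points to find one with the largest value of the objective function;
`best` is the best point so far and `v` its value. -/
def findBest : Node W → V → List (Node W) → Prog W V (Node W)
  | best, _, [] => do
    tick
    return best
  | best, v, e :: E => do
    tick
    let w ← query e.point
    if ← cmpVal v w then
      findBest e w E
    else
      findBest best v E

/-- The forward dynamic programming algorithm in the plane, with Graham's scan for the construction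
of the extreme points. Input: the matrices `A_1, …, A_m`, the initial vector `a` and the number `K`
of periods; the objective function is accessed through the oracle. Output: the matrices
`T_0, …, T_{K-1}`. -/
def forwardDP (As : List (Matrix (Fin 2) (Fin 2) W)) (a : Fin 2 → W) (K : ℕ) :
    Prog W V (List (Matrix (Fin 2) (Fin 2) W)) := do
  let E₀ ← cons ⟨a, []⟩ []
  let E ← mainLoop As K E₀
  tick
  match E with
  | [] => return []
  | e :: E' =>
    let v ← query e.point
    let best ← findBest e v E'
    reverseOnto best.path []

end Algorithm

end SwitchedSystem

/-! The running time is controlled by the correctness of the algorithm. If `E_k` lists, without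
repetition, extreme points of `P_k(Σ, a)` only, then `|E_k| ≤ N_k(Σ, a) ≤ N_k(Σ)`. Round `k` forms
`l = m |E_k|` points and spends O(l log l) on them, the sort being the dominant part. Since log(m
N_k) = log m + log N_k, summing over `k` gives the two terms of the bound; lower-order terms are
absorbed because `m ≥ 2` and `N_k ≥ 1` keep log(m N_k) away from zero.

The invariant is `IsFrontier`. It survives a round because linear maps commute with convex hulls
(`polytope_succ`), so only the hull of `E_k` matters, and because Graham's scan returns distinct
extreme points with the same hull as its input (`grahamScan_spec`).

For the scan, the stack is a `ConvexChain`: all its triples turn left, not just consecutive ones.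
The local test at the top of the stack implies this global property by Grassmann–Plücker identities
(`ConvexChain.cons_of_leftTurn`). A discarded point lies in a triangle or segment spanned by other
points, so the hull is unchanged. Each vertex of a chain is the strict minimizer of a linear
functional, hence extreme. An amortized count of the pops makes the scan linear.

The final enumeration runs over `E_K`, but `N_K` is absent from the bound; there `|E_K| ≤ m
|E_{K-1}|` is used instead. -/

namespace SwitchedSystem

/-! ## Values and running times of the subroutines -/

namespace Prog

variable {α β : Type} (f : (Fin 2 → ℝ) → ℝ)

theorem value_bind (p : Prog ℤ ℝ α) (g : α → Prog ℤ ℝ β) :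
    (p >>= g).value f = (g (p.value f)).value f := by
  change (Prog.bind p g).value f = _
  induction p with
  | ret x => rfl
  | step k ih => exact ih
  | _ => rename_i ih; exact ih _

theorem steps_bind (p : Prog ℤ ℝ α) (g : α → Prog ℤ ℝ β) :
    (p >>= g).steps f = p.steps f + (g (p.value f)).steps f := by
  change (Prog.bind p g).steps f = _
  induction p with
  | ret x => exact (zero_add _).symm
  | step k ih => exact (congrArg (· + 1) ih).trans (add_right_comm _ _ _)
  | _ => rename_i ih; exact (congrArg (· + 1) (ih _)).trans (add_right_comm _ _ _)

theorem value_pure (x : α) : (pure x : Prog ℤ ℝ α).value f = x := rfl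

theorem steps_pure (x : α) : (pure x : Prog ℤ ℝ α).steps f = 0 := rfl

theorem value_ite (c : Prop) [Decidable c] (p q : Prog ℤ ℝ α) :
    (if c then p else q).value f = if c then p.value f else q.value f := by
  split_ifs <;> rfl

theorem steps_ite (c : Prop) [Decidable c] (p q : Prog ℤ ℝ α) :
    (if c then p else q).steps f = if c then p.steps f else q.steps f := by
  split_ifs <;> rfl

end Prog

open Prog

section Instructions

variable {α : Type} (f : (Fin 2 → ℝ) → ℝ)

theorem steps_tick : (tick : Prog ℤ ℝ Unit).steps f = 1 := rfl

theorem value_arith (op : ArithOp) (x y : ℤ) :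
    (arith op x y : Prog ℤ ℝ ℤ).value f = op.eval x y := rfl

theorem value_cmp (op : CmpOp) (x y : ℤ) :
    (cmp op x y : Prog ℤ ℝ Bool).value f = op.eval x y := rfl

theorem steps_cmp (op : CmpOp) (x y : ℤ) : (cmp op x y : Prog ℤ ℝ Bool).steps f = 1 := rfl

theorem steps_query (p : Fin 2 → ℤ) : (query p : Prog ℤ ℝ ℝ).steps f = 1 := rfl

theorem steps_cmpVal (u v : ℝ) : (cmpVal u v : Prog ℤ ℝ Bool).steps f = 1 := rfl

theorem value_cons (x : α) (l : List α) : (cons x l : Prog ℤ ℝ (List α)).value f = x :: l := rfl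

theorem steps_cons (x : α) (l : List α) : (cons x l : Prog ℤ ℝ (List α)).steps f = 1 := rfl

theorem value_length (l : List α) : (length l : Prog ℤ ℝ ℕ).value f = l.length := by
  induction l with
  | nil => rfl
  | cons x l ih => simp [length, value_bind, value_pure, ih]

theorem steps_length (l : List α) : (length l : Prog ℤ ℝ ℕ).steps f = 2 * l.length + 1 := by
  induction l with
  | nil => rfl
  | cons x l ih => simp [length, steps_bind, steps_pure, steps_tick, ih]; omega

theorem steps_reverseOnto (l acc : List α) :
    (reverseOnto l acc : Prog ℤ ℝ (List α)).steps f = 2 * l.length + 1 := by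
  induction l generalizing acc with
  | nil => rfl
  | cons x l ih => simp [reverseOnto, steps_bind, steps_tick, steps_cons, ih]; omega

end Instructions

/-! ### Merge sort -/

section MergeSort

variable {α : Type} (f : (Fin 2 → ℝ) → ℝ) {le : α → α → Prog ℤ ℝ Bool}

theorem perm_merge (l l' : List α) : ((merge le l l').value f).Perm (l ++ l') := by
  induction l, l' using merge.induct with
  | case1 l => simp [merge, value_bind, value_pure]
  | case2 x l => simp [merge, value_bind, value_pure]
  | case3 x l y l' ih₁ ih₂ =>
    rw [merge]
    simp only [value_bind, value_ite, value_cons]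
    split_ifs
    · exact ih₁.cons x
    · exact (ih₂.cons y).trans List.perm_middle.symm

theorem steps_merge_le {d : ℕ} (hd : ∀ x y, (le x y).steps f ≤ d) (l l' : List α) :
    (merge le l l').steps f ≤ (d + 2) * (l.length + l'.length) + 1 := by
  induction l, l' using merge.induct with
  | case1 l => simp [merge, steps_bind, steps_pure, steps_tick]
  | case2 x l => simp [merge, steps_bind, steps_pure, steps_tick]
  | case3 x l y l' ih₁ ih₂ =>
    rw [merge]
    simp only [steps_bind, steps_ite, steps_cons, steps_tick]
    have := hd x y
    simp only [List.length_cons] at *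
    split_ifs <;> nlinarith

/-- Totality and transitivity are asked only on `P`: the angular order around a pivot is cyclic on
the whole plane and becomes transitive only on the half-plane above the pivot. -/
theorem pairwise_merge {r : α → α → Prop} {P : α → Prop}
    (hle : ∀ x y, (le x y).value f = true ↔ r x y)
    (total : ∀ x y, P x → P y → r x y ∨ r y x)
    (trans : ∀ x y z, P x → P y → P z → r x y → r y z → r x z) (l l' : List α)
    (hP : ∀ x ∈ l ++ l', P x) (hl : l.Pairwise r) (hl' : l'.Pairwise r) :
    ((merge le l l').value f).Pairwise r := by
  induction l, l' using merge.induct with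
  | case1 l => simpa [merge, value_bind, value_pure] using hl'
  | case2 x l => simpa [merge, value_bind, value_pure] using hl
  | case3 x l y l' ih₁ ih₂ =>
    rw [merge]
    simp only [value_bind, value_ite, value_cons]
    have hx : P x := hP x (by simp)
    have hy : P y := hP y (by simp)
    split_ifs with h
    · rw [hle] at h
      refine List.pairwise_cons.2 ⟨fun z hz => ?_,
        ih₁ (fun z hz => hP z (by simp_all)) hl.of_cons hl'⟩
      rw [(perm_merge f _ _).mem_iff, List.mem_append] at hz
      rcases hz with hz | hz
      · exact (List.pairwise_cons.1 hl).1 z hz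
      · rcases List.mem_cons.1 hz with rfl | hz'
        · exact h
        · exact trans x y z hx hy (hP z (by simp_all)) h ((List.pairwise_cons.1 hl').1 z hz')
    · rw [hle] at h
      have h' : r y x := (total x y hx hy).resolve_left h
      refine List.pairwise_cons.2 ⟨fun z hz => ?_,
        ih₂ (fun z hz => hP z (by simp at hz ⊢; tauto)) hl hl'.of_cons⟩
      rw [(perm_merge f _ _).mem_iff, List.mem_append] at hz
      rcases hz with hz | hz
      · rcases List.mem_cons.1 hz with rfl | hz'
        · exact h'
        · exact trans y x z hy hx (hP z (by simp_all)) h' ((List.pairwise_cons.1 hl).1 z hz')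
      · exact (List.pairwise_cons.1 hl').1 z hz

theorem value_mergeSort (c : ℕ) (l : List α) :
    (((mergeSort le c l).value f).1).Perm (l.take c) ∧
      ((mergeSort le c l).value f).2 = l.drop c := by
  induction c using Nat.strong_induction_on generalizing l with
  | _ c ih =>
    match c, l with
    | 0, l => simp [mergeSort, value_bind, value_pure]
    | 1, [] => simp [mergeSort, value_bind, value_pure]
    | 1, x :: l => simp [mergeSort, value_bind, value_pure, value_cons]
    | c + 2, l =>
      obtain ⟨h₁, h₂⟩ := ih ((c + 2) / 2) (by omega) l
      obtain ⟨h₃, h₄⟩ := ih ((c + 2) - (c + 2) / 2) (by omega) (l.drop ((c + 2) / 2))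
      rw [mergeSort]
      simp only [value_bind, value_pure]
      rw [h₂]
      constructor
      · refine (perm_merge f _ _).trans ((h₁.append h₃).trans ?_)
        rw [← List.take_add]
        rw [show (c + 2) / 2 + (c + 2 - (c + 2) / 2) = c + 2 by omega]
      · rw [h₄, List.drop_drop]
        congr 1
        omega

theorem pairwise_mergeSort {r : α → α → Prop} {P : α → Prop}
    (hle : ∀ x y, (le x y).value f = true ↔ r x y)
    (total : ∀ x y, P x → P y → r x y ∨ r y x)
    (trans : ∀ x y z, P x → P y → P z → r x y → r y z → r x z) (c : ℕ) (l : List α)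
    (hP : ∀ x ∈ l, P x) : (((mergeSort le c l).value f).1).Pairwise r := by
  induction c using Nat.strong_induction_on generalizing l with
  | _ c ih =>
    match c, l with
    | 0, l => simp [mergeSort, value_bind, value_pure]
    | 1, [] => simp [mergeSort, value_bind, value_pure]
    | 1, x :: l => simp [mergeSort, value_bind, value_pure, value_cons]
    | c + 2, l =>
      have hP' : ∀ x ∈ l.drop ((c + 2) / 2), P x := fun x hx => hP x (List.mem_of_mem_drop hx)
      rw [mergeSort]
      simp only [value_bind, value_pure]
      rw [(value_mergeSort f _ _).2]
      refine pairwise_merge f hle total trans _ _ (fun x hx => ?_) (ih _ (by omega) _ hP)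
        (ih _ (by omega) _ hP')
      rcases List.mem_append.1 hx with hx | hx
      · exact hP x (List.mem_of_mem_take ((value_mergeSort f _ _).1.subset hx))
      · exact hP' x (List.mem_of_mem_take ((value_mergeSort f _ _).1.subset hx))

/-- The term `1 - min c 1` vanishes for `c ≥ 1`, so no constants accumulate over the two halves. The
coefficient `d + 6` covers the `d + 2` per merged entry and the 4 further steps of each call. -/
theorem steps_mergeSort_le {d : ℕ} (hd : ∀ x y, (le x y).steps f ≤ d) (c : ℕ) (l : List α) :
    (mergeSort le c l).steps f ≤ (d + 6) * (c * Nat.clog 2 c) + 2 * c + 1 - min c 1 := by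
  induction c using Nat.strong_induction_on generalizing l with
  | _ c ih =>
    match c, l with
    | 0, l => simp [mergeSort, steps_bind, steps_pure, steps_tick]
    | 1, [] => simp [mergeSort, steps_bind, steps_pure, steps_tick]
    | 1, x :: l => simp [mergeSort, steps_bind, steps_pure, steps_tick, steps_cons]
    | c + 2, l =>
      -- The second half is the larger one; rounding up makes its logarithm exactly one less than
      -- that of `c + 2`.
      obtain ⟨k, hk⟩ : ∃ k, k = Nat.clog 2 (c + 2 - (c + 2) / 2) := ⟨_, rfl⟩
      have hclog : Nat.clog 2 (c + 2) = k + 1 := by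
        rw [Nat.clog_of_two_le (by norm_num) (by omega), hk]
        congr 2
        omega
      have hk' : Nat.clog 2 ((c + 2) / 2) ≤ k := hk ▸ Nat.clog_mono_right 2 (by omega)
      have h₁ := ih ((c + 2) / 2) (by omega) l
      have h₂ := ih ((c + 2) - (c + 2) / 2) (by omega) ((mergeSort le ((c + 2) / 2) l).value f).2
      rw [← hk] at h₂
      have h₃ := steps_merge_le f hd ((mergeSort le ((c + 2) / 2) l).value f).1
        ((mergeSort le ((c + 2) - (c + 2) / 2)
          ((mergeSort le ((c + 2) / 2) l).value f).2).value f).1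
      have hlen₁ : ((mergeSort le ((c + 2) / 2) l).value f).1.length ≤ (c + 2) / 2 := by
        rw [(value_mergeSort f _ _).1.length_eq]
        exact List.length_take_le _ _
      have hlen₂ : ((mergeSort le ((c + 2) - (c + 2) / 2)
          ((mergeSort le ((c + 2) / 2) l).value f).2).value f).1.length ≤
          (c + 2) - (c + 2) / 2 := by
        rw [(value_mergeSort f _ _).1.length_eq]
        exact List.length_take_le _ _
      obtain ⟨x, y, hx, hy, hx0, hy0, hxy⟩ : ∃ x y, x = (c + 2) / 2 ∧
          y = (c + 2) - (c + 2) / 2 ∧ 1 ≤ x ∧ 1 ≤ y ∧ c + 2 = x + y :=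
        ⟨_, _, rfl, rfl, by omega, by omega, by omega⟩
      have h₅ := h₃.trans (Nat.add_le_add_right
        (Nat.mul_le_mul_left (d + 2) (Nat.add_le_add hlen₁ hlen₂)) 1)
      rw [mergeSort, hclog]
      simp only [steps_bind, steps_pure, steps_tick]
      generalize (merge le _ _).steps f = w at h₅ ⊢
      clear h₃ hlen₁ hlen₂
      generalize (mergeSort le ((c + 2) / 2) l).steps f = u at *
      generalize (mergeSort le ((c + 2) - (c + 2) / 2)
          ((mergeSort le ((c + 2) / 2) l).value f).2).steps f = v at *
      rw [← hx] at h₁ hk'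
      rw [← hy] at h₂
      rw [← hy, ← hx] at h₅
      rw [hxy]
      rw [min_eq_right (by omega)] at *
      have h₄ : (d + 6) * (x * Nat.clog 2 x) ≤ (d + 6) * (x * k) := by gcongr
      have h₆ : (d + 6) * ((x + y) * (k + 1)) =
        (d + 6) * (x * k) + (d + 6) * (y * k) + (d + 2) * (x + y) + 4 * (x + y) := by ring
      omega

end MergeSort

/-! ## Graham's scan -/

/-- Twice the signed area of the triangle `o p q`. -/
def orient (o p q : Node ℤ) : ℤ :=
  (p.point 0 - o.point 0) * (q.point 1 - o.point 1) -
    (p.point 1 - o.point 1) * (q.point 0 - o.point 0)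

/-- The squared distance of `p` from `o`. -/
def normSq (o p : Node ℤ) : ℤ :=
  (p.point 0 - o.point 0) * (p.point 0 - o.point 0) +
    (p.point 1 - o.point 1) * (p.point 1 - o.point 1)

/-- The point `p` is strictly higher than `o`, or equally high and strictly to its right. -/
def Above (o p : Node ℤ) : Prop :=
  o.point 1 < p.point 1 ∨ o.point 1 = p.point 1 ∧ o.point 0 < p.point 0

/-- The order by polar angle around `o`, at equal angles by distance from `o`. -/
def AngleLE (o p q : Node ℤ) : Prop :=
  0 < orient o p q ∨ orient o p q = 0 ∧ normSq o p ≤ normSq o q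

theorem point_eq_iff (p q : Node ℤ) :
    p.point = q.point ↔ p.point 0 = q.point 0 ∧ p.point 1 = q.point 1 := by
  rw [funext_iff, Fin.forall_fin_two]

/-! ### Values and running times of the predicates -/

section Predicates

variable (f : (Fin 2 → ℝ) → ℝ) (o p q : Node ℤ)

theorem value_lowerLeft :
    (lowerLeft p q : Prog ℤ ℝ Bool).value f = true ↔ Above p q := by
  simp only [lowerLeft, value_bind, value_ite, value_pure, Above]
  split_ifs <;> simp_all [value_cmp, CmpOp.eval]

theorem steps_lowerLeft_le : (lowerLeft p q : Prog ℤ ℝ Bool).steps f ≤ 3 := by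
  simp only [lowerLeft, steps_bind, steps_ite, steps_cmp, steps_pure]
  split_ifs <;> omega

theorem value_samePoint :
    (samePoint p q : Prog ℤ ℝ Bool).value f = true ↔ p.point = q.point := by
  simp only [samePoint, value_bind, value_ite, value_pure, point_eq_iff]
  split_ifs <;> simp_all [value_cmp, CmpOp.eval]

theorem steps_samePoint_le : (samePoint p q : Prog ℤ ℝ Bool).steps f ≤ 2 := by
  simp only [samePoint, steps_bind, steps_ite, steps_cmp, steps_pure]
  split_ifs <;> omega

theorem value_leftTurn :
    (leftTurn o p q : Prog ℤ ℝ Bool).value f = true ↔ 0 < orient o p q := by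
  simp [leftTurn, crossTerms, value_bind, value_arith, value_cmp, value_pure, CmpOp.eval,
    ArithOp.eval, orient]

theorem steps_leftTurn : (leftTurn o p q : Prog ℤ ℝ Bool).steps f = 7 := rfl

theorem value_collinear :
    (collinear o p q : Prog ℤ ℝ Bool).value f = true ↔ orient o p q = 0 := by
  simp [collinear, crossTerms, value_bind, value_arith, value_cmp, value_pure, CmpOp.eval,
    ArithOp.eval, orient, sub_eq_zero]

theorem steps_collinear : (collinear o p q : Prog ℤ ℝ Bool).steps f = 7 := rfl

theorem value_distSq : (distSq o p : Prog ℤ ℝ ℤ).value f = normSq o p := rfl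

theorem steps_distSq : (distSq o p : Prog ℤ ℝ ℤ).steps f = 5 := rfl

theorem value_angleLe : (angleLe o p q : Prog ℤ ℝ Bool).value f = true ↔ AngleLE o p q := by
  simp only [angleLe, value_bind, value_ite, value_cmp, value_pure, CmpOp.eval, value_distSq,
    value_leftTurn, value_collinear, AngleLE]
  split_ifs <;> simp_all

theorem steps_angleLe_le : (angleLe o p q : Prog ℤ ℝ Bool).steps f ≤ 25 := by
  simp only [angleLe, steps_bind, steps_ite, steps_cmp, steps_pure, steps_distSq, steps_leftTurn,
    steps_collinear]
  split_ifs <;> omega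

end Predicates

/-! ### Orientation of triples -/

section Orientation

variable {o p q r : Node ℤ}

theorem orient_rotate (o p q : Node ℤ) : orient p q o = orient o p q := by
  simp only [orient]; ring

theorem orient_swap (o p q : Node ℤ) : orient o q p = -orient o p q := by
  simp only [orient]; ring

/-- Seen from `o`, the three points lie in a half-open half-plane. The Plücker relation with the
horizontal direction writes `qy` times the orientation of `o p r` as a combination of the other two
with coefficients `ry, py ≥ 0`. If `qy = 0`, then `q` has the smallest possible angle and `p` must
share it. -/
theorem orient_trans (hp : Above o p) (hq : Above o q) (hr : Above o r)
    (hpq : 0 ≤ orient o p q) (hqr : 0 ≤ orient o q r) :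
    0 ≤ orient o p r ∧ (orient o p r = 0 → orient o p q = 0 ∧ orient o q r = 0) := by
  have hc : ∀ a b : Node ℤ, Above a b ↔
      0 < b.point 1 - a.point 1 ∨ b.point 1 - a.point 1 = 0 ∧ 0 < b.point 0 - a.point 0 := by
    intro a b; unfold Above; omega
  rw [hc] at hp hq hr
  simp only [orient] at *
  generalize p.point 0 - o.point 0 = px at *
  generalize p.point 1 - o.point 1 = py at *
  generalize q.point 0 - o.point 0 = qx at *
  generalize q.point 1 - o.point 1 = qy at *
  generalize r.point 0 - o.point 0 = rx at *
  generalize r.point 1 - o.point 1 = ry at *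
  have hp0 : 0 ≤ py := by omega
  have hr0 : 0 ≤ ry := by omega
  rcases hq with hq | ⟨rfl, hq⟩
  · have key : qy * (px * ry - py * rx) =
        ry * (px * qy - py * qx) + py * (qx * ry - qy * rx) := by ring
    refine ⟨nonneg_of_mul_nonneg_right (key ▸ by positivity) hq, fun h => ?_⟩
    rw [h, mul_zero] at key
    have h₁ : ry * (px * qy - py * qx) = 0 := by nlinarith
    have h₂ : py * (qx * ry - qy * rx) = 0 := by nlinarith
    have hry : ry ≠ 0 := by
      rintro rfl
      have := mul_pos hq (show 0 < rx by omega)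
      linarith
    have h₃ := (mul_eq_zero.1 h₁).resolve_left hry
    refine ⟨h₃, (mul_eq_zero.1 h₂).resolve_left ?_⟩
    rintro rfl
    have := mul_pos (show 0 < px by omega) hq
    linarith
  · have hpy : py = 0 := by nlinarith
    subst hpy
    have hpx : 0 < px := by omega
    refine ⟨by nlinarith, fun h => ⟨by ring, ?_⟩⟩
    have : ry = 0 := by nlinarith
    rw [this]; ring

theorem AngleLE.trans (hp : Above o p) (hq : Above o q) (hr : Above o r)
    (hpq : AngleLE o p q) (hqr : AngleLE o q r) : AngleLE o p r := by
  have h := orient_trans hp hq hr (hpq.elim le_of_lt fun h => h.1.ge)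
    (hqr.elim le_of_lt fun h => h.1.ge)
  rcases h.1.lt_or_eq with h' | h'
  · exact Or.inl h'
  · obtain ⟨h₁, h₂⟩ := h.2 h'.symm
    exact Or.inr ⟨h'.symm, (hpq.resolve_left (by omega)).2.trans (hqr.resolve_left (by omega)).2⟩

theorem AngleLE.total (o p q : Node ℤ) : AngleLE o p q ∨ AngleLE o q p := by
  have := orient_swap o p q
  unfold AngleLE
  omega

theorem orient_pos_trans (hp : Above o p) (hq : Above o q) (hr : Above o r)
    (hpq : 0 < orient o p q) (hqr : 0 ≤ orient o q r) : 0 < orient o p r := by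
  have h := orient_trans hp hq hr hpq.le hqr
  rcases h.1.lt_or_eq with h' | h'
  · exact h'
  · have := (h.2 h'.symm).1
    omega

/-- Four-point consequence of the Grassmann–Plücker relation. -/
theorem orient_pos_of_last {x u t p : Node ℤ} (hxt : 0 < orient o x t) (hut : 0 < orient o u t)
    (htp : 0 < orient o t p) (hxut : 0 < orient x u t) (hutp : 0 < orient u t p) :
    0 < orient x t p := by
  have key : orient o u t * orient x t p =
      orient o x t * orient u t p + orient o t p * orient x u t := by
    simp only [orient]; ring
  exact (mul_pos_iff_of_pos_left hut).1 (key ▸ by positivity)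

/-- The same relation around `y`: it passes from turns at the top `t` to a pair `x`, `y` deeper in
the stack. -/
theorem orient_pos_of_first {x y t p : Node ℤ} (hxy : 0 < orient o x y) (hyt : 0 < orient o y t)
    (hyp : 0 < orient o y p) (hxyt : 0 < orient x y t) (hytp : 0 < orient y t p) :
    0 < orient x y p := by
  have key : orient o y t * orient x y p =
      orient o x y * orient y t p + orient o y p * orient x y t := by
    simp only [orient]; ring
  exact (mul_pos_iff_of_pos_left hyt).1 (key ▸ by positivity)

end Orientation

/-! ### Convex hulls of lists of nodes -/

/-- The point of the real plane that is stored in a node. -/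
def realPoint (e : Node ℤ) : Fin 2 → ℝ := fun i => (e.point i : ℝ)

/-- The convex hull of the points of a list. -/
def hull (E : List (Node ℤ)) : Set (Fin 2 → ℝ) := convexHull ℝ (realPoint '' {e | e ∈ E})

section Hull

variable {o p q : Node ℤ} {E F : List (Node ℤ)}

theorem realPoint_injective_iff : realPoint p = realPoint q ↔ p.point = q.point := by
  simp [realPoint, funext_iff]

theorem convex_hull (E : List (Node ℤ)) : Convex ℝ (hull E) := convex_convexHull ℝ _

theorem realPoint_mem_hull (h : p ∈ E) : realPoint p ∈ hull E :=
  subset_convexHull ℝ _ ⟨p, h, rfl⟩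

theorem hull_subset (h : ∀ p ∈ E, realPoint p ∈ hull F) : hull E ⊆ hull F :=
  convexHull_min (by rintro _ ⟨p, hp, rfl⟩; exact h p hp) (convex_hull F)

theorem hull_mono (h : E ⊆ F) : hull E ⊆ hull F :=
  hull_subset fun _ hp => realPoint_mem_hull (h hp)

/-- Barycentric coordinates over the common denominator `d`, so that integer orientations and inner
products can serve as weights. -/
theorem realPoint_mem_of_combination {s : Set (Fin 2 → ℝ)} (hs : Convex ℝ s) {o u p t : Node ℤ}
    {d x y : ℤ} (hd : 0 < d) (hx : 0 ≤ x) (hy : 0 ≤ y) (hxy : x + y ≤ d)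
    (h : ∀ i, d * (t.point i - o.point i) =
      x * (u.point i - o.point i) + y * (p.point i - o.point i))
    (ho : realPoint o ∈ s) (hu : realPoint u ∈ s) (hp : realPoint p ∈ s) : realPoint t ∈ s := by
  have hd' : (0 : ℝ) < d := by exact_mod_cast hd
  have hx' : (0 : ℝ) ≤ x := by exact_mod_cast hx
  have hy' : (0 : ℝ) ≤ y := by exact_mod_cast hy
  have hxy' : (x : ℝ) + y ≤ d := by exact_mod_cast hxy
  have ht : realPoint t = ((d - x - y) / d : ℝ) • realPoint o + (x / d : ℝ) • realPoint u +
      (y / d : ℝ) • realPoint p := by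
    ext i
    have h' : (d : ℝ) * (t.point i - o.point i) =
      x * (u.point i - o.point i) + y * (p.point i - o.point i) := by exact_mod_cast h i
    simp only [realPoint, Pi.add_apply, Pi.smul_apply, smul_eq_mul]
    field_simp
    linarith
  rw [ht]
  have := hs.sum_mem (t := Finset.univ) (w := ![((d - x - y) / d : ℝ), (x / d : ℝ), (y / d : ℝ)])
    (z := ![realPoint o, realPoint u, realPoint p]) ?_ ?_ ?_
  · simpa [Fin.sum_univ_three] using this
  · have h₀ : (0 : ℝ) ≤ (d - x - y) / d := div_nonneg (by linarith) hd'.le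
    intro i _
    fin_cases i
    · exact h₀
    · exact div_nonneg hx' hd'.le
    · exact div_nonneg hy' hd'.le
  · simp only [Fin.sum_univ_three, Matrix.cons_val]
    field_simp
    ring
  · intro i _
    fin_cases i <;> assumption

/-- A point that does not lie strictly outside of the edge `u p` lies in the triangle `o u p`. -/
theorem realPoint_mem_of_orient {s : Set (Fin 2 → ℝ)} (hs : Convex ℝ s) {o u p t : Node ℤ}
    (hut : 0 < orient o u t) (htp : 0 < orient o t p) (hup : 0 < orient o u p)
    (hutp : orient u t p ≤ 0)
    (ho : realPoint o ∈ s) (hu : realPoint u ∈ s) (hp : realPoint p ∈ s) : realPoint t ∈ s := by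
  -- Cramer's rule gives the weights; the weight left for `o` is `-orient u t p`.
  refine realPoint_mem_of_combination hs hup htp.le hut.le ?_ ?_ ho hu hp
  · have : orient u t p = orient o u t + orient o t p - orient o u p := by
      simp only [orient]; ring
    linarith
  · rw [Fin.forall_fin_two]
    constructor <;> (simp only [orient]; ring)

theorem Above.normSq_pos (h : Above o p) : 0 < normSq o p := by
  unfold Above at h
  unfold normSq
  rcases h with h | ⟨-, h⟩ <;>
    nlinarith [mul_self_nonneg (p.point 0 - o.point 0),
      mul_self_nonneg (p.point 1 - o.point 1)]

/-- Of two points at the same polar angle, the nearer one lies on the segment from the pivot to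
the other one. -/
theorem realPoint_mem_of_collinear {s : Set (Fin 2 → ℝ)} (hs : Convex ℝ s) {o p q : Node ℤ}
    (hp : Above o p) (hq : Above o q) (hpq : orient o p q = 0) (hle : normSq o p ≤ normSq o q)
    (ho : realPoint o ∈ s) (hq' : realPoint q ∈ s) : realPoint p ∈ s := by
  -- Orthogonal projection onto the ray through `q`: the weight of `q` is the inner product over
  -- `normSq o q`. The third vertex is a dummy.
  refine realPoint_mem_of_combination hs (y := 0)
    (x := (p.point 0 - o.point 0) * (q.point 0 - o.point 0) +
      (p.point 1 - o.point 1) * (q.point 1 - o.point 1)) hq.normSq_pos ?_ le_rfl ?_ ?_ ho hq' ho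
  · have hc : ∀ a b : Node ℤ, Above a b ↔
        0 < b.point 1 - a.point 1 ∨ b.point 1 - a.point 1 = 0 ∧ 0 < b.point 0 - a.point 0 := by
      intro a b; unfold Above; omega
    rw [hc] at hp hq
    unfold orient at hpq
    generalize p.point 0 - o.point 0 = px at *
    generalize p.point 1 - o.point 1 = py at *
    generalize q.point 0 - o.point 0 = qx at *
    generalize q.point 1 - o.point 1 = qy at *
    have hp0 : 0 ≤ py := by omega
    rcases hq with hq | ⟨rfl, hq⟩
    · have h : qy * (px * qx + py * qy) = py * (qx * qx + qy * qy) := by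
        linear_combination qx * hpq
      exact nonneg_of_mul_nonneg_right
        (h ▸ mul_nonneg hp0 (add_nonneg (mul_self_nonneg _) (mul_self_nonneg _))) hq
    · have hpy : py = 0 := by nlinarith
      subst hpy
      have hpx : 0 < px := by omega
      nlinarith
  · rw [add_zero]
    refine abs_le_of_sq_le_sq' ?_ hq.normSq_pos.le |>.2
    -- Lagrange's identity.
    calc _ = normSq o p * normSq o q - orient o p q ^ 2 := by simp only [normSq, orient]; ring
      _ ≤ normSq o q ^ 2 := by rw [hpq]; nlinarith [hq.normSq_pos]
  · unfold orient at hpq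
    rw [Fin.forall_fin_two]
    constructor <;> simp only [normSq]
    · linear_combination (q.point 1 - o.point 1) * hpq
    · linear_combination -(q.point 0 - o.point 0) * hpq

end Hull

/-! ### Strictly convex chains -/

/-- All triples of a list of points, the last one first, are positively oriented. -/
def ConvexChain : List (Node ℤ) → Prop
  | [] => True
  | p :: s => s.Pairwise (fun y x => 0 < orient x y p) ∧ ConvexChain s

theorem convexChain_append_singleton (L : List (Node ℤ)) (x : Node ℤ) :
    ConvexChain (L ++ [x]) ↔ ConvexChain (x :: L) := by
  induction L with
  | nil => rfl
  | cons p s ih =>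
    simp only [List.cons_append, ConvexChain, ih, List.pairwise_append, List.pairwise_cons,
      orient_rotate x]
    simp
    tauto

/-- Orientation is invariant under cyclic permutation, so any vertex can be rotated to the top and
extremality need only be shown there. -/
theorem ConvexChain.swap {L L' : List (Node ℤ)} (h : ConvexChain (L ++ L')) :
    ConvexChain (L' ++ L) := by
  induction L generalizing L' with
  | nil => simpa using h
  | cons a L ih =>
    have := ih (L' := L' ++ [a]) (by
      rw [← List.append_assoc, convexChain_append_singleton]; exact h)
    simpa using this

/-- The top of a strictly convex chain is a strict minimizer of a linear functional. -/
theorem ConvexChain.exists_functional_of_cons {v : Node ℤ} {L : List (Node ℤ)}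
    (h : ConvexChain (v :: L)) (hv : ∀ x ∈ L, x.point ≠ v.point) :
    ∃ w : Fin 2 → ℤ, ∀ x ∈ L, w 0 * v.point 0 + w 1 * v.point 1 <
      w 0 * x.point 0 + w 1 * x.point 1 := by
  rcases L with _ | ⟨b, L⟩
  · exact ⟨0, by simp⟩
  rcases L.eq_nil_or_concat with rfl | ⟨M, a, rfl⟩
  -- With two points there are no triples, and distinctness alone provides the functional.
  · refine ⟨fun i => b.point i - v.point i, ?_⟩
    simp only [List.mem_singleton, forall_eq]
    have hb := hv b (by simp)
    rw [Ne, point_eq_iff, not_and_or] at hb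
    rcases hb with hb | hb
    · have := mul_self_pos.2 (sub_ne_zero.2 hb)
      nlinarith [mul_self_nonneg (b.point 1 - v.point 1)]
    · have := mul_self_pos.2 (sub_ne_zero.2 hb)
      nlinarith [mul_self_nonneg (b.point 0 - v.point 0)]
  -- The cyclic neighbours of `v` are `b` and `a`. The functional is a normal of the chord joining
  -- them, and its increase from `v` to `x` is the sum of two nonnegative orientations, which do not
  -- both vanish.
  · refine ⟨![b.point 1 - a.point 1, a.point 0 - b.point 0], ?_⟩
    have hp := h.1
    rw [List.pairwise_cons, List.concat_eq_append, List.pairwise_append] at hp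
    obtain ⟨hb, -, -, ha⟩ := hp
    have hab : 0 < orient a b v := hb a (by simp)
    have key : ∀ x : Node ℤ, orient x b v + orient a x v =
        ((b.point 1 - a.point 1) * x.point 0 + (a.point 0 - b.point 0) * x.point 1) -
        ((b.point 1 - a.point 1) * v.point 0 + (a.point 0 - b.point 0) * v.point 1) := by
      intro x; simp only [orient]; ring
    intro x hx
    rw [List.concat_eq_append] at hx
    simp only [Matrix.cons_val_zero, Matrix.cons_val_one]
    rw [← sub_pos, ← key]
    rcases List.mem_cons.1 hx with rfl | hx
    · have : orient x x v = 0 := by simp only [orient]; ring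
      omega
    · have hxb := hb x hx
      rcases List.mem_append.1 hx with hx | hx
      · have := ha x hx a (by simp)
        omega
      · rw [List.mem_singleton] at hx
        subst hx
        have : orient x x v = 0 := by simp only [orient]; ring
        omega

/-- A strict minimizer of a linear functional on a set is an extreme point of the convex hull. -/
theorem mem_extremePoints_of_forall_lt {s : Set (Fin 2 → ℝ)} {v : Fin 2 → ℝ} (hv : v ∈ s)
    (φ : (Fin 2 → ℝ) →ₗ[ℝ] ℝ) (h : ∀ x ∈ s, x ≠ v → φ v < φ x) :
    v ∈ (convexHull ℝ s).extremePoints ℝ := by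
  have hmin : ∀ x ∈ convexHull ℝ s, x = v ∨ φ v < φ x := by
    -- An open half-plane together with one boundary point is convex.
    have hc : Convex ℝ {x | x = v ∨ φ v < φ x} := by
      intro x hx y hy a b ha hb hab
      rcases ha.eq_or_lt with rfl | ha
      · obtain rfl : b = 1 := by linarith
        simpa using hy
      rcases hb.eq_or_lt with rfl | hb
      · obtain rfl : a = 1 := by linarith
        simpa using hx
      obtain rfl : b = 1 - a := by linarith
      simp only [Set.mem_ofPred_eq, map_add, map_smul, smul_eq_mul] at *
      rcases hx with rfl | hx
      · rcases hy with rfl | hy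
        · left; rw [← add_smul]; simp
        · right; nlinarith
      · right
        rcases hy with rfl | hy
        · nlinarith
        · nlinarith
    exact fun x hx => convexHull_min (fun x hx => or_iff_not_imp_left.2 (h x hx)) hc hx
  refine mem_extremePoints_iff_left.2 ⟨subset_convexHull ℝ s hv, fun x hx y hy hxy => ?_⟩
  obtain ⟨a, b, ha, hb, hab, hxyv⟩ := hxy
  obtain rfl : b = 1 - a := by linarith
  by_contra hne
  have hx' := (hmin x hx).resolve_left hne
  have hφ : a * φ x + (1 - a) * φ y = φ v := by
    simpa only [map_add, map_smul, smul_eq_mul] using congrArg φ hxyv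
  have hy' : φ v ≤ φ y := (hmin y hy).elim (fun h => h ▸ le_rfl) le_of_lt
  nlinarith

theorem ConvexChain.realPoint_mem_extremePoints {L : List (Node ℤ)} (h : ConvexChain L)
    (hnd : (L.map Node.point).Nodup) {v : Node ℤ} (hv : v ∈ L) :
    realPoint v ∈ (hull L).extremePoints ℝ := by
  obtain ⟨L₁, L₂, rfl⟩ := List.append_of_mem hv
  have hperm : (L₁ ++ v :: L₂).Perm (v :: (L₂ ++ L₁)) :=
    List.perm_middle.trans (List.perm_append_comm.cons v)
  have hnd' := (hperm.map Node.point).nodup_iff.1 hnd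
  rw [List.map_cons, List.nodup_cons] at hnd'
  obtain ⟨w, hw⟩ := ConvexChain.exists_functional_of_cons (v := v) (L := L₂ ++ L₁) h.swap
    (fun x hx he => hnd'.1 (he ▸ List.mem_map_of_mem hx))
  refine mem_extremePoints_of_forall_lt ⟨v, hv, rfl⟩
    ((w 0 : ℝ) • LinearMap.proj 0 + (w 1 : ℝ) • LinearMap.proj 1) ?_
  rintro _ ⟨x, hx, rfl⟩ hne
  rcases List.mem_cons.1 (hperm.subset hx) with rfl | hx
  · exact absurd rfl hne
  · simpa [realPoint] using (by exact_mod_cast hw x hx :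
      (w 0 * v.point 0 + w 1 * v.point 1 : ℝ) < w 0 * x.point 0 + w 1 * x.point 1)

/-- A point that makes a left turn at the top of a chain can be put on top of it. -/
theorem ConvexChain.cons_of_leftTurn {o p t u : Node ℤ} {r : List (Node ℤ)}
    (h : ConvexChain (t :: u :: r ++ [o])) (hp : ∀ x ∈ t :: u :: r, 0 < orient o x p)
    (hturn : 0 < orient u t p) : ConvexChain (p :: (t :: u :: r ++ [o])) := by
  have ho : (t :: u :: r).Pairwise (fun y x => 0 < orient o x y) := by
    have h' := (convexChain_append_singleton _ _).1 h
    refine h'.1.imp fun h => ?_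
    rwa [orient_rotate] at h
  obtain ⟨ht, hu⟩ := List.pairwise_cons.1 ho
  -- The tested turn over `u`, `t` extends to every point below `t`; pairs below `t` then follow
  -- from `orient_pos_of_first`.
  have htop : ∀ x ∈ u :: r, 0 < orient x t p := by
    intro x hx
    rcases List.mem_cons.1 hx with rfl | hx
    · exact hturn
    · refine orient_pos_of_last (ht x (by simp [hx])) (ht u (by simp)) (hp t (by simp)) ?_ hturn
      have := (List.pairwise_cons.1 h.1).1 x (by simp [hx])
      exact this
  refine ⟨?_, h⟩
  rw [List.pairwise_append]
  refine ⟨List.pairwise_cons.2 ⟨htop, ?_⟩, List.pairwise_singleton _ _, ?_⟩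
  · have h₁ : ((u :: r) ++ [o]).Pairwise (fun y x => 0 < orient x y t) := h.1
    rw [List.pairwise_append] at h₁
    refine (hu.and h₁.1).imp_of_mem fun {y x} hy hx hyx => ?_
    exact orient_pos_of_first hyx.1 (ht y hy) (hp y (by simp [List.mem_cons.1 hy])) hyx.2
      (htop y hy)
  · simpa using hp

/-! ### The parts of the scan -/

section Parts

variable (f : (Fin 2 → ℝ) → ℝ)

theorem value_findPivot (p : Node ℤ) (l : List (Node ℤ)) :
    (findPivot p l : Prog ℤ ℝ (Node ℤ)).value f ∈ p :: l ∧
      ∀ q ∈ p :: l, ¬ Above q ((findPivot p l : Prog ℤ ℝ (Node ℤ)).value f) := by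
  induction l generalizing p with
  | nil => simp [findPivot, value_bind, value_pure, Above]
  | cons q l ih =>
    simp only [findPivot, value_bind, value_ite]
    split_ifs with h <;> rw [value_lowerLeft] at h
    · obtain ⟨h₁, h₂⟩ := ih q
      refine ⟨List.mem_cons_of_mem _ h₁, fun x hx => ?_⟩
      rcases List.mem_cons.1 hx with rfl | hx
      · have := h₂ q (by simp)
        unfold Above at *
        omega
      · exact h₂ x hx
    · obtain ⟨h₁, h₂⟩ := ih p
      refine ⟨by simp only [List.mem_cons] at *; tauto, fun x hx => ?_⟩
      rcases List.mem_cons.1 hx with rfl | hx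
      · exact h₂ x (by simp)
      · rcases List.mem_cons.1 hx with rfl | hx
        · have := h₂ p (by simp)
          unfold Above at *
          omega
        · exact h₂ x (by simp [hx])

theorem steps_findPivot_le (p : Node ℤ) (l : List (Node ℤ)) :
    (findPivot p l : Prog ℤ ℝ (Node ℤ)).steps f ≤ 4 * l.length + 1 := by
  induction l generalizing p with
  | nil => simp [findPivot, steps_bind, steps_pure, steps_tick]
  | cons q l ih =>
    simp only [findPivot, steps_bind, steps_ite, steps_tick, List.length_cons]
    have := steps_lowerLeft_le f q p
    have h₁ := ih q
    have h₂ := ih p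
    split_ifs <;> omega

theorem value_removePivot (o : Node ℤ) (l : List (Node ℤ)) :
    (removePivot o l : Prog ℤ ℝ (List (Node ℤ))).value f =
      l.filter fun p => p.point ≠ o.point := by
  induction l with
  | nil => rfl
  | cons p l ih =>
    simp only [removePivot, value_bind, value_ite, value_samePoint, value_pure, value_cons, ih,
      List.filter_cons]
    split_ifs <;> simp_all

theorem steps_removePivot_le (o : Node ℤ) (l : List (Node ℤ)) :
    (removePivot o l : Prog ℤ ℝ (List (Node ℤ))).steps f ≤ 4 * l.length + 1 := by
  induction l with
  | nil => simp [removePivot, steps_bind, steps_pure, steps_tick]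
  | cons p l ih =>
    simp only [removePivot, steps_bind, steps_ite, steps_tick, steps_pure, steps_cons,
      List.length_cons]
    have := steps_samePoint_le f p o
    split_ifs <;> omega

theorem value_keepFarthest (o : Node ℤ) (l : List (Node ℤ)) (hl : l.Pairwise (AngleLE o))
    (ho : ∀ p ∈ l, Above o p) :
    List.Sublist ((keepFarthest o l : Prog ℤ ℝ (List (Node ℤ))).value f) l ∧
    ((keepFarthest o l : Prog ℤ ℝ (List (Node ℤ))).value f).Pairwise
      (fun p q => 0 < orient o p q) ∧
    ∀ p ∈ l, realPoint p ∈ hull (o :: (keepFarthest o l : Prog ℤ ℝ (List (Node ℤ))).value f) := by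
  induction l using keepFarthest.induct with
  | case1 => simp [keepFarthest, value_bind, value_pure]
  | case2 p =>
    simpa [keepFarthest, value_bind, value_pure] using realPoint_mem_hull (by simp)
  | case3 p q l ih =>
    obtain ⟨hs, hpw, hh⟩ := ih hl.of_cons fun x hx => ho x (by simp [List.mem_cons.1 hx])
    simp only [keepFarthest, value_bind, value_ite, value_collinear, value_pure, value_cons]
    generalize (keepFarthest o (q :: l) : Prog ℤ ℝ (List (Node ℤ))).value f = r at *
    have hpq : AngleLE o p q := (List.pairwise_cons.1 hl).1 q (by simp)
    split_ifs with h
    · refine ⟨hs.cons p, hpw, fun x hx => ?_⟩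
      rcases List.mem_cons.1 hx with rfl | hx
      · exact realPoint_mem_of_collinear (convex_hull _) (ho _ (by simp)) (ho q (by simp)) h
          (hpq.resolve_left (by omega)).2 (realPoint_mem_hull (by simp)) (hh q (by simp))
      · exact hh x hx
    · refine ⟨hs.cons_cons p, List.pairwise_cons.2 ⟨fun x hx => ?_, hpw⟩, fun x hx => ?_⟩
      -- A strict increase of angle from `p` to its successor is strict for every later point as
      -- well.
      · have hpq' : 0 < orient o p q := hpq.resolve_right (by omega)
        rcases List.mem_cons.1 (hs.subset hx) with rfl | hx
        · exact hpq'
        · refine orient_pos_trans (ho p (by simp)) (ho q (by simp)) (ho x (by simp [hx])) hpq' ?_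
          exact ((List.pairwise_cons.1 hl.of_cons).1 x hx).elim le_of_lt fun h => h.1.ge
      · rcases List.mem_cons.1 hx with rfl | hx
        · exact realPoint_mem_hull (by simp)
        · exact hull_mono (List.cons_subset_cons o (List.subset_cons_self p r)) (hh x hx)

theorem steps_keepFarthest_le (o : Node ℤ) (l : List (Node ℤ)) :
    (keepFarthest o l : Prog ℤ ℝ (List (Node ℤ))).steps f ≤ 9 * l.length + 1 := by
  induction l using keepFarthest.induct with
  | case1 => simp [keepFarthest, steps_bind, steps_pure, steps_tick]
  | case2 p => simp [keepFarthest, steps_bind, steps_pure, steps_tick]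
  | case3 p q l ih =>
    simp only [keepFarthest, steps_bind, steps_ite, steps_tick, steps_pure, steps_cons,
      steps_collinear, List.length_cons] at *
    split_ifs <;> omega

/-- Amortized count: each stack entry carries a credit of 8, the price of one pop (7 for the turn
test, 1 for the loop). The pivot stays at the bottom, since a turn from `o` over the last remaining
point is always left. -/
theorem popNonLeft_spec {o p : Node ℤ} (r : List (Node ℤ)) (hr : ConvexChain (r ++ [o]))
    (hp : ∀ t ∈ r, 0 < orient o t p) :
    ∃ r', (popNonLeft p (r ++ [o]) : Prog ℤ ℝ (List (Node ℤ))).value f = r' ++ [o] ∧ r' <:+ r ∧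
      ConvexChain (p :: (r' ++ [o])) ∧ (∀ t ∈ r, realPoint t ∈ hull (p :: (r' ++ [o]))) ∧
      (popNonLeft p (r ++ [o]) : Prog ℤ ℝ (List (Node ℤ))).steps f + 8 * r'.length ≤
        8 * r.length + 8 := by
  match r with
  | [] =>
    refine ⟨[], ?_, List.suffix_refl _, ?_, by simp, ?_⟩
    · simp [popNonLeft, value_bind, value_pure]
    · simp [ConvexChain]
    · simp [popNonLeft, steps_bind, steps_pure, steps_tick]
  | [t] =>
    have ht : 0 < orient o t p := hp t (by simp)
    have ht' : (leftTurn o t p : Prog ℤ ℝ Bool).value f = true := (value_leftTurn ..).2 ht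
    refine ⟨[t], ?_, List.suffix_refl _, ?_, fun x hx => realPoint_mem_hull (by simp_all), ?_⟩
    · simp [popNonLeft, value_bind, value_pure, ht']
    · simpa [ConvexChain] using ht
    · simp [popNonLeft, steps_bind, steps_pure, steps_tick, ht', steps_leftTurn]
  | t :: u :: r =>
    by_cases hturn : 0 < orient u t p
    · have ht' : (leftTurn u t p : Prog ℤ ℝ Bool).value f = true := (value_leftTurn ..).2 hturn
      refine ⟨t :: u :: r, ?_, List.suffix_refl _, hr.cons_of_leftTurn hp hturn,
        fun x hx => realPoint_mem_hull (List.mem_cons_of_mem _ (List.mem_append_left _ hx)), ?_⟩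
      · simp [popNonLeft, value_bind, value_pure, ht']
      · simp [popNonLeft, steps_bind, steps_pure, steps_tick, ht', steps_leftTurn]
        omega
    · have ht' : ¬ (leftTurn u t p : Prog ℤ ℝ Bool).value f = true := by
        rwa [value_leftTurn]
      obtain ⟨r', h₁, h₂, h₃, h₄, h₅⟩ := popNonLeft_spec (o := o) (p := p) (u :: r) hr.2
        fun x hx => hp x (by simp [List.mem_cons.1 hx])
      refine ⟨r', ?_, h₂.trans (List.suffix_cons t _), h₃, ?_, ?_⟩
      · simpa [popNonLeft, value_bind, value_ite, ht'] using h₁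
      · intro x hx
        rcases List.mem_cons.1 hx with rfl | hx
        -- The popped `t` lies in the triangle `o u p`; `u` may itself be popped later, but the
        -- recursive call keeps it in the hull.
        · have hut := (List.pairwise_cons.1 hr.1).1 o (by simp)
          exact realPoint_mem_of_orient (convex_hull _) hut (hp _ (by simp)) (hp u (by simp))
            (not_lt.1 hturn) (realPoint_mem_hull (by simp)) (h₄ u (by simp))
            (realPoint_mem_hull (by simp))
        · exact h₄ x hx
      · simp only [List.cons_append, popNonLeft, steps_bind, steps_ite, steps_tick,
          steps_leftTurn, ht', List.length_cons] at *
        simp at *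
        omega

/-- The 18 per point is 2 for loop and push, 8 for the final turn test and 8 of credit for the new
entry. -/
theorem scan_spec {o : Node ℤ} (l r : List (Node ℤ)) (hr : ConvexChain (r ++ [o]))
    (hrl : ∀ t ∈ r, ∀ q ∈ l, 0 < orient o t q) (hl : l.Pairwise fun p q => 0 < orient o p q) :
    ∃ r', (scan (r ++ [o]) l : Prog ℤ ℝ (List (Node ℤ))).value f = r' ++ [o] ∧ r' ⊆ r ++ l ∧
      ConvexChain (r' ++ [o]) ∧ (∀ t ∈ r ++ l, realPoint t ∈ hull (r' ++ [o])) ∧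
      (scan (r ++ [o]) l : Prog ℤ ℝ (List (Node ℤ))).steps f ≤
        8 * r.length + 18 * l.length + 1 := by
  induction l generalizing r with
  | nil =>
    refine ⟨r, ?_, by simp, hr, fun x hx => realPoint_mem_hull (by simp_all), ?_⟩
    · simp [scan, value_bind, value_pure]
    · simp [scan, steps_bind, steps_pure, steps_tick]
  | cons p l ih =>
    obtain ⟨r₁, h₁, h₂, h₃, h₄, h₅⟩ := popNonLeft_spec f r hr fun t ht => hrl t ht p (by simp)
    obtain ⟨hp, hl'⟩ := List.pairwise_cons.1 hl
    obtain ⟨r', e₁, e₂, e₃, e₄, e₅⟩ := ih (p :: r₁) h₃ (fun t ht q hq => by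
      rcases List.mem_cons.1 ht with rfl | ht
      · exact hp q hq
      · exact hrl t (h₂.subset ht) q (by simp [hq])) hl'
    refine ⟨r', ?_, ?_, e₃, ?_, ?_⟩
    · simpa [scan, value_bind, value_cons, h₁] using e₁
    · intro x hx
      have := e₂ hx
      simp only [List.cons_append, List.mem_cons, List.mem_append] at *
      rcases this with h | h | h
      · exact Or.inr (Or.inl h)
      · exact Or.inl (h₂.subset h)
      · exact Or.inr (Or.inr h)
    · intro x hx
      have ho : realPoint o ∈ hull (r' ++ [o]) := realPoint_mem_hull (by simp)
      rcases List.mem_append.1 hx with hx | hx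
      · refine hull_subset (fun y hy => ?_) (h₄ x hx)
        rw [← List.cons_append] at hy
        rcases List.mem_append.1 hy with hy | hy
        · exact e₄ y (List.mem_append_left _ hy)
        · rw [List.mem_singleton.1 hy]; exact ho
      · exact e₄ x (by simp only [List.cons_append, List.mem_cons, List.mem_append] at *; tauto)
    · simp only [scan, steps_bind, steps_tick, steps_cons, value_cons, h₁, List.length_cons]
      simp only [List.cons_append, List.length_cons] at e₅
      omega

/-- The 31 is `d + 6` with `d = 25` for one angular comparison; 39 = 4 + 4 + 2 + 2 + 9 + 18 collects
the linear parts in order of execution. -/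
theorem grahamScan_spec (F : List (Node ℤ)) (hF : F ≠ []) :
    ∃ E, (grahamScan F : Prog ℤ ℝ (List (Node ℤ))).value f = E ∧ E ≠ [] ∧ E ⊆ F ∧
      (E.map Node.point).Nodup ∧ hull E = hull F ∧
      (∀ e ∈ E, realPoint e ∈ (hull F).extremePoints ℝ) ∧
      (grahamScan F : Prog ℤ ℝ (List (Node ℤ))).steps f ≤
        31 * (F.length * Nat.clog 2 F.length) + 39 * F.length + 8 := by
  obtain ⟨p, l, rfl⟩ := List.exists_cons_of_ne_nil hF
  have hpiv := value_findPivot f p l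
  have s₁ := steps_findPivot_le f p l
  obtain ⟨o, ho⟩ : ∃ o, o = (findPivot p l : Prog ℤ ℝ (Node ℤ)).value f := ⟨_, rfl⟩
  rw [← ho] at hpiv
  have s₂ := steps_removePivot_le f o (p :: l)
  obtain ⟨R, hR⟩ : ∃ R, R = (p :: l).filter fun q => decide (q.point ≠ o.point) := ⟨_, rfl⟩
  have hRlen : R.length ≤ (p :: l).length := hR ▸ List.length_filter_le _ _
  have hRabove : ∀ q ∈ R, Above o q := by
    intro q hq
    rw [hR, List.mem_filter, decide_eq_true_eq, Ne, point_eq_iff] at hq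
    have := hpiv.2 q hq.1
    unfold Above at *
    omega
  have s₃ := steps_length f R
  have s₄ := steps_mergeSort_le f (le := angleLe o) (steps_angleLe_le f o) R.length R
  have hsort := value_mergeSort f (le := angleLe o) R.length R
  have hpw := pairwise_mergeSort f (le := angleLe o) (r := AngleLE o) (P := Above o)
    (value_angleLe f o) (fun x y _ _ => AngleLE.total o x y)
    (fun x y z hx hy hz => AngleLE.trans hx hy hz) R.length R hRabove
  rw [List.take_length] at hsort
  obtain ⟨M, hM⟩ : ∃ M, M = ((mergeSort (angleLe o) R.length R).value f : _ × _).1 := ⟨_, rfl⟩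
  rw [← hM] at hsort hpw
  have hMabove : ∀ q ∈ M, Above o q := fun q hq => hRabove q (hsort.1.subset hq)
  obtain ⟨k₁, k₂, k₃⟩ := value_keepFarthest f o M hpw hMabove
  have s₅ := steps_keepFarthest_le f o M
  obtain ⟨N, hN⟩ : ∃ N, N = (keepFarthest o M : Prog ℤ ℝ (List (Node ℤ))).value f := ⟨_, rfl⟩
  rw [← hN] at k₁ k₂ k₃
  obtain ⟨r, e₁, e₂, e₃, e₄, s₆⟩ := scan_spec f (o := o) N [] ⟨by simp, trivial⟩ (by simp) k₂
  simp only [List.nil_append, List.length_nil] at e₁ e₂ e₄ s₆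
  have hrF : r ⊆ p :: l := fun x hx => by
    have := hsort.1.subset (k₁.subset (e₂ hx))
    rw [hR] at this
    exact (List.mem_filter.1 this).1
  have hEF : r ++ [o] ⊆ p :: l := List.append_subset.2 ⟨hrF, by simpa using hpiv.1⟩
  -- Points of `r` differ because their angles around `o` do; none equals `o` because all lie above
  -- it.
  have hnd : ((r ++ [o]).map Node.point).Nodup := by
    have h' := (convexChain_append_singleton _ _).1 e₃
    rw [List.map_append, List.nodup_append']
    refine ⟨?_, by simp, ?_⟩
    · rw [List.Nodup, List.pairwise_map]
      refine h'.1.imp fun {y x} h he => ?_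
      simp [orient, he] at h
    · intro x hx hx'
      obtain ⟨y, hy, rfl⟩ := List.mem_map.1 hx
      have hya := hMabove y (k₁.subset (e₂ hy))
      simp only [List.map_cons, List.map_nil, List.mem_singleton] at hx'
      simp [Above, hx'] at hya
  have hhull : hull (r ++ [o]) = hull (p :: l) := by
    refine (hull_mono hEF).antisymm (hull_subset fun x hx => ?_)
    have ho' : realPoint o ∈ hull (r ++ [o]) := realPoint_mem_hull (by simp)
    by_cases hxo : x.point = o.point
    · rwa [realPoint_injective_iff.2 hxo]
    · have hxM : x ∈ M := hsort.1.symm.subset (by rw [hR, List.mem_filter]; simp [hx, hxo])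
      refine hull_subset (fun y hy => ?_) (k₃ x hxM)
      rcases List.mem_cons.1 hy with rfl | hy
      · exact ho'
      · exact e₄ y hy
  refine ⟨r ++ [o], ?_, by simp, hEF, hnd, hhull,
    fun e he => hhull ▸ e₃.realPoint_mem_extremePoints hnd he, ?_⟩
  · simp only [grahamScan, value_bind, value_cons, value_removePivot, value_length, ← ho, ← hR,
      ← hM, ← hN, e₁]
  · simp only [grahamScan, steps_bind, value_cons, value_removePivot, value_length,
      steps_tick, steps_cons, ← ho, ← hR, ← hM, ← hN]
    have hMlen : M.length = R.length := hsort.1.length_eq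
    have hNlen := k₁.length_le
    have hclog : R.length * Nat.clog 2 R.length ≤
        (p :: l).length * Nat.clog 2 (p :: l).length :=
      Nat.mul_le_mul hRlen (Nat.clog_mono_right 2 hRlen)
    have hl : (p :: l).length = l.length + 1 := rfl
    omega

end Parts

/-! ## The forward dynamic programming algorithm -/

section Frontier

variable {n : ℕ}

theorem reachable_succ (S : Set (Matrix (Fin n) (Fin n) ℝ)) (a : Fin n → ℝ) (k : ℕ) :
    reachable S a (k + 1) = Set.image2 (fun T x => T.mulVec x) S (reachable S a k) := by
  refine (reachable_succ_subset S a k).antisymm ?_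
  rintro _ ⟨A, hA, _, ⟨T, hT, rfl⟩, rfl⟩
  -- The matrix with index `k` acts only after time `k`.
  have htraj : ∀ j ≤ k, trajectory (Function.update T k A) a j = trajectory T a j := by
    intro j hj
    induction j with
    | zero => rfl
    | succ j ih =>
      rw [trajectory, trajectory, ih (by omega), Function.update_of_ne (by omega)]
  refine ⟨Function.update T k A, fun j hj => ?_, ?_⟩
  · rcases eq_or_ne j k with rfl | hne
    · simpa using hA
    · rw [Function.update_of_ne hne]
      exact hT j (by omega)
  · rw [trajectory, htraj k le_rfl, Function.update_self]

theorem convexHull_image2_mulVec (S : Set (Matrix (Fin n) (Fin n) ℝ)) (X : Set (Fin n → ℝ)) :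
    convexHull ℝ (Set.image2 (fun T x => T.mulVec x) S (convexHull ℝ X)) =
      convexHull ℝ (Set.image2 (fun T x => T.mulVec x) S X) := by
  refine (convexHull_min ?_ (convex_convexHull ℝ _)).antisymm
    (convexHull_mono (Set.image2_subset_left (subset_convexHull ℝ X)))
  rintro _ ⟨T, hT, x, hx, rfl⟩
  have h : T.mulVec x ∈ T.mulVecLin '' convexHull ℝ X := ⟨x, hx, rfl⟩
  rw [LinearMap.image_convexHull] at h
  refine convexHull_mono ?_ h
  rintro _ ⟨y, hy, rfl⟩
  exact ⟨T, hT, y, hy, rfl⟩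

/-- This justifies the pruning: any set with hull `P_k`, in particular its extreme points,
determines `P_{k+1}`. -/
theorem polytope_succ (S : Set (Matrix (Fin n) (Fin n) ℝ)) (a : Fin n → ℝ) (k : ℕ)
    {X : Set (Fin n → ℝ)} (hX : convexHull ℝ X = polytope S a k) :
    polytope S a (k + 1) = convexHull ℝ (Set.image2 (fun T x => T.mulVec x) S X) := by
  rw [← convexHull_image2_mulVec S X, hX, polytope, polytope, convexHull_image2_mulVec,
    reachable_succ]

end Frontier

/-- The list `E` stores, without repetition, the extreme points of the polytope `P_k(Σ, a)`. -/
structure IsFrontier (S : Set (Matrix (Fin 2) (Fin 2) ℝ)) (a : Fin 2 → ℝ) (k : ℕ)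
    (E : List (Node ℤ)) : Prop where
  ne_nil : E ≠ []
  nodup : (E.map Node.point).Nodup
  hull_eq : hull E = polytope S a k
  extreme : ∀ e ∈ E, realPoint e ∈ (polytope S a k).extremePoints ℝ
  path_length : ∀ e ∈ E, e.path.length = k

theorem IsFrontier.length_le {S : Set (Matrix (Fin 2) (Fin 2) ℝ)} (hS : S.Finite)
    {a : Fin 2 → ℝ} {k : ℕ} {E : List (Node ℤ)} (h : IsFrontier S a k E) :
    E.length ≤ numExtreme S k := by
  classical
  -- Finiteness matters twice: an unbounded supremum in `ℕ` and the `ncard` of an infinite set are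
  -- both 0 by convention.
  refine le_trans ?_ (le_ciSup (bddAbove_numExtremeAt hS k) a)
  have hfin : ((polytope S a k).extremePoints ℝ).Finite :=
    (reachable_finite_ncard hS a k).1.subset extremePoints_convexHull_subset
  have hnd : (E.map realPoint).Nodup := by
    have := h.nodup
    rw [List.Nodup, List.pairwise_map] at this ⊢
    exact this.imp fun hne => by rwa [Ne, realPoint_injective_iff]
  calc E.length = (E.map realPoint).toFinset.card := by
        rw [List.toFinset_card_of_nodup hnd, List.length_map]
    _ = ((E.map realPoint).toFinset : Set (Fin 2 → ℝ)).ncard := (Set.ncard_coe_finset _).symm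
    _ ≤ _ := Set.ncard_le_ncard (by
        intro x hx
        simp only [List.coe_toFinset, List.mem_map] at hx
        obtain ⟨e, he, rfl⟩ := hx
        exact h.extreme e he) hfin

theorem isFrontier_zero (S : Set (Matrix (Fin 2) (Fin 2) ℝ)) (a : Fin 2 → ℤ) :
    IsFrontier S (fun i => (a i : ℝ)) 0 [⟨a, []⟩] := by
  have hp : polytope S (fun i => (a i : ℝ)) 0 = {fun i => (a i : ℝ)} := by
    rw [polytope, reachable_zero, convexHull_singleton]
  refine ⟨by simp, by simp, ?_, ?_, by simp⟩
  · rw [hp, hull]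
    convert convexHull_singleton (𝕜 := ℝ) (fun i => (a i : ℝ))
    ext x
    simp only [List.mem_singleton, Set.mem_image, Set.mem_ofPred_eq, exists_eq_left,
      Set.mem_singleton_iff]
    exact eq_comm
  · rw [hp, extremePoints_singleton]
    simp only [List.mem_singleton, forall_eq]
    rfl

/-! ### Invariant and cost of the main loop -/

section Loop

variable (f : (Fin 2 → ℝ) → ℝ)

theorem value_applyMatrix (A : Matrix (Fin 2) (Fin 2) ℤ) (p : Fin 2 → ℤ) :
    (applyMatrix A p : Prog ℤ ℝ (Fin 2 → ℤ)).value f = A.mulVec p := by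
  simp only [applyMatrix, value_bind, value_arith, value_pure, ArithOp.eval]
  ext i
  fin_cases i <;> simp [Matrix.mulVec, dotProduct, Fin.sum_univ_two]

theorem steps_applyMatrix (A : Matrix (Fin 2) (Fin 2) ℤ) (p : Fin 2 → ℤ) :
    (applyMatrix A p : Prog ℤ ℝ (Fin 2 → ℤ)).steps f = 6 := rfl

/-- The node that is reached from `e` by means of the matrix `A`. -/
def child (A : Matrix (Fin 2) (Fin 2) ℤ) (e : Node ℤ) : Node ℤ := ⟨A.mulVec e.point, A :: e.path⟩

theorem realPoint_child (A : Matrix (Fin 2) (Fin 2) ℤ) (e : Node ℤ) :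
    realPoint (child A e) = (A.map fun z : ℤ => (z : ℝ)).mulVec (realPoint e) := by
  ext i
  simp only [realPoint, child, Matrix.mulVec, dotProduct, Matrix.map_apply]
  push_cast
  rfl

theorem image_spec (A : Matrix (Fin 2) (Fin 2) ℤ) (E acc : List (Node ℤ)) :
    (image A E acc : Prog ℤ ℝ (List (Node ℤ))).value f = (E.map (child A)).reverse ++ acc ∧
      (image A E acc : Prog ℤ ℝ (List (Node ℤ))).steps f = 9 * E.length + 1 := by
  induction E generalizing acc with
  | nil => simp [image, value_bind, value_pure, steps_bind, steps_pure, steps_tick]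
  | cons e E ih =>
    simp only [image, value_bind, value_cons, value_applyMatrix, steps_bind, steps_tick,
      steps_cons, steps_applyMatrix, ih]
    refine ⟨by simp [child], ?_⟩
    rw [List.length_cons]
    omega

theorem images_spec (As : List (Matrix (Fin 2) (Fin 2) ℤ)) (E acc : List (Node ℤ)) :
    (∀ x, x ∈ (images As E acc : Prog ℤ ℝ (List (Node ℤ))).value f ↔
        x ∈ acc ∨ ∃ A ∈ As, ∃ e ∈ E, child A e = x) ∧
      ((images As E acc : Prog ℤ ℝ (List (Node ℤ))).value f).length =
        As.length * E.length + acc.length ∧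
      (images As E acc : Prog ℤ ℝ (List (Node ℤ))).steps f =
        9 * (As.length * E.length) + 2 * As.length + 1 := by
  induction As generalizing acc with
  | nil => simp [images, value_bind, value_pure, steps_bind, steps_pure, steps_tick]
  | cons A As ih =>
    obtain ⟨h₁, h₂⟩ := image_spec f A E acc
    obtain ⟨h₃, h₄, h₅⟩ := ih ((E.map (child A)).reverse ++ acc)
    simp only [images, value_bind, steps_bind, steps_tick, h₁, h₂, h₃, h₄, h₅]
    refine ⟨fun x => ?_, ?_, ?_⟩
    · simp only [List.mem_append, List.mem_reverse, List.mem_map, List.exists_mem_cons_iff]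
      rw [or_assoc, or_left_comm]
    · simp only [List.length_append, List.length_reverse, List.length_map, List.length_cons]
      ring
    · simp only [List.length_cons]
      ring

variable {f} {S : Set (Matrix (Fin 2) (Fin 2) ℝ)} {a : Fin 2 → ℝ}
  {As : List (Matrix (Fin 2) (Fin 2) ℤ)}

theorem finite_of_mem_iff (hS : ∀ T, T ∈ S ↔ ∃ A ∈ As, A.map (fun z : ℤ => (z : ℝ)) = T) :
    S.Finite := by
  refine (As.finite_toSet.image fun A => A.map (fun z : ℤ => (z : ℝ))).subset fun T hT => ?_
  obtain ⟨A, hA, rfl⟩ := (hS T).1 hT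
  exact ⟨A, hA, rfl⟩

/-- With `l = m |E|`, 59 = 39 + 9 + 2 + 9: the scan, the images, the loop over the matrices (`m ≤
l`), and the constants 1 + 8 (`1 ≤ l`). -/
theorem IsFrontier.grahamScan_images (hAs : As ≠ [])
    (hS : ∀ T, T ∈ S ↔ ∃ A ∈ As, A.map (fun z : ℤ => (z : ℝ)) = T) {k : ℕ} {E : List (Node ℤ)}
    (h : IsFrontier S a k E) {F : List (Node ℤ)}
    (hF : F = (images As E [] : Prog ℤ ℝ (List (Node ℤ))).value f) :
    IsFrontier S a (k + 1) ((grahamScan F : Prog ℤ ℝ (List (Node ℤ))).value f) ∧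
      ((grahamScan F : Prog ℤ ℝ (List (Node ℤ))).value f).length ≤ As.length * E.length ∧
      (images As E [] : Prog ℤ ℝ (List (Node ℤ))).steps f +
        (grahamScan F : Prog ℤ ℝ (List (Node ℤ))).steps f ≤
        31 * (As.length * E.length * Nat.clog 2 (As.length * E.length)) +
          59 * (As.length * E.length) := by
  obtain ⟨hmem, hlen, hsteps⟩ := images_spec f As E []
  rw [← hF] at hmem hlen
  simp only [List.not_mem_nil, false_or] at hmem
  rw [List.length_nil, add_zero] at hlen
  have hm : 1 ≤ As.length := List.length_pos_of_ne_nil hAs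
  have hE : 1 ≤ E.length := List.length_pos_of_ne_nil h.ne_nil
  have hm' : As.length ≤ As.length * E.length := Nat.le_mul_of_pos_right _ hE
  have hhull : hull F = polytope S a (k + 1) := by
    rw [polytope_succ S a k h.hull_eq, hull]
    congr 1
    ext x
    constructor
    · rintro ⟨y, hy, rfl⟩
      obtain ⟨A, hA, e, he, rfl⟩ := (hmem y).1 hy
      exact ⟨_, (hS _).2 ⟨A, hA, rfl⟩, _, ⟨e, he, rfl⟩, (realPoint_child A e).symm⟩
    · rintro ⟨T, hT, _, ⟨e, he, rfl⟩, rfl⟩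
      obtain ⟨A, hA, rfl⟩ := (hS T).1 hT
      exact ⟨child A e, (hmem _).2 ⟨A, hA, e, he, rfl⟩, realPoint_child A e⟩
  obtain ⟨E', hE', g₁, g₂, g₃, g₄, g₅, g₆⟩ := grahamScan_spec f F
    (List.ne_nil_of_length_pos (by omega))
  rw [hE']
  refine ⟨⟨g₁, g₃, g₄.trans hhull, fun e he => hhull ▸ g₅ e he, fun e he => ?_⟩, ?_, ?_⟩
  · obtain ⟨A, -, x, hx, rfl⟩ := (hmem e).1 (g₂ he)
    rw [child, List.length_cons, h.path_length x hx]
  · rw [← hlen]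
    exact (g₃.of_map _ |>.subperm g₂).length_le
  · rw [hlen] at g₆
    omega

/-- The length bound avoids the number of extreme points at time `k + j`, which the final estimate
may not use; `E.length` serves the case `j = 0`. The 60 is 59 plus the tick of an iteration. -/
theorem IsFrontier.mainLoop (hAs : As ≠ [])
    (hS : ∀ T, T ∈ S ↔ ∃ A ∈ As, A.map (fun z : ℤ => (z : ℝ)) = T) (j : ℕ) {k : ℕ}
    {E : List (Node ℤ)} (h : IsFrontier S a k E) :
    IsFrontier S a (k + j) ((mainLoop As j E : Prog ℤ ℝ (List (Node ℤ))).value f) ∧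
      ((mainLoop As j E : Prog ℤ ℝ (List (Node ℤ))).value f).length ≤
        E.length + ∑ i ∈ Finset.range j, As.length * numExtreme S (k + i) ∧
      (mainLoop As j E : Prog ℤ ℝ (List (Node ℤ))).steps f ≤
        ∑ i ∈ Finset.range j, (31 * (As.length * numExtreme S (k + i) *
          Nat.clog 2 (As.length * numExtreme S (k + i))) +
          60 * (As.length * numExtreme S (k + i))) + 1 := by
  have hSfin := finite_of_mem_iff hS
  induction j generalizing k E with
  | zero =>
    simpa [SwitchedSystem.mainLoop, value_bind, value_pure, steps_bind, steps_pure, steps_tick]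
      using h
  | succ j ih =>
    obtain ⟨F, hF⟩ : ∃ F, F = (images As E [] : Prog ℤ ℝ (List (Node ℤ))).value f := ⟨_, rfl⟩
    obtain ⟨h₁, h₂, h₃⟩ := h.grahamScan_images hAs hS hF
    obtain ⟨i₁, i₂, i₃⟩ := ih h₁
    have hm : 1 ≤ As.length := List.length_pos_of_ne_nil hAs
    have hE : 1 ≤ E.length := List.length_pos_of_ne_nil h.ne_nil
    have hpos : 1 ≤ As.length * E.length := Nat.mul_pos hm hE
    have hle : As.length * E.length ≤ As.length * numExtreme S k :=
      Nat.mul_le_mul_left _ (h.length_le hSfin)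
    have hclog := Nat.mul_le_mul hle (Nat.clog_mono_right 2 hle)
    simp only [SwitchedSystem.mainLoop, value_bind, steps_bind, steps_tick, ← hF,
      Finset.sum_range_succ' _ j, add_zero]
    simp only [add_assoc, add_comm 1] at i₁ i₂ i₃ ⊢
    refine ⟨i₁, ?_, ?_⟩
    · omega
    · omega

/-! ### Enumeration, retrieval of the matrices, total cost -/

theorem steps_findBest (best : Node ℤ) (v : ℝ) (E : List (Node ℤ)) :
    (findBest best v E : Prog ℤ ℝ (Node ℤ)).steps f = 3 * E.length + 1 := by
  induction E generalizing best v with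
  | nil => rfl
  | cons e E ih =>
    simp only [findBest, steps_bind, steps_ite, steps_tick, steps_query, steps_cmpVal, ih,
      List.length_cons, ite_self]
    omega

theorem value_findBest_mem (best : Node ℤ) (v : ℝ) (E : List (Node ℤ)) :
    (findBest best v E : Prog ℤ ℝ (Node ℤ)).value f ∈ best :: E := by
  induction E generalizing best v with
  | nil => simp [findBest, value_bind, value_pure]
  | cons e E ih =>
    simp only [findBest, value_bind, value_ite]
    split_ifs
    · exact List.mem_cons_of_mem _ (ih e _)
    · have := ih best v
      simp only [List.mem_cons] at this ⊢
      tauto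

/-- The algorithm itself exhibits an extreme point: started at the origin, its frontier at time `k`
is nonempty. -/
theorem one_le_numExtreme (hAs : As ≠ [])
    (hS : ∀ T, T ∈ S ↔ ∃ A ∈ As, A.map (fun z : ℤ => (z : ℝ)) = T) (k : ℕ) :
    1 ≤ numExtreme S k := by
  have hSfin := finite_of_mem_iff hS
  have h := ((isFrontier_zero S 0).mainLoop (f := 0) hAs hS k).1
  rw [zero_add] at h
  exact (List.length_pos_of_ne_nil h.ne_nil).trans_le (h.length_le hSfin)

theorem steps_forwardDP_le (hAs : As ≠ [])
    (hS : ∀ T, T ∈ S ↔ ∃ A ∈ As, A.map (fun z : ℤ => (z : ℝ)) = T) (a : Fin 2 → ℤ) {K : ℕ}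
    (hK : 1 ≤ K) :
    (forwardDP As a K).steps f ≤
      ∑ k ∈ Finset.range K, (31 * (As.length * numExtreme S k *
        Nat.clog 2 (As.length * numExtreme S k)) + 75 * (As.length * numExtreme S k)) := by
  obtain ⟨h₁, h₂, h₃⟩ := (isFrontier_zero S a).mainLoop (f := f) hAs hS K
  have hm : 1 ≤ As.length := List.length_pos_of_ne_nil hAs
  -- This pays for reversing the path of length `K` and, as `1 ≤ K`, for all additive constants.
  -- Raising 60 to 75 leaves room for these and for the enumeration.
  have hK' : K ≤ ∑ k ∈ Finset.range K, As.length * numExtreme S k := by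
    calc K = ∑ k ∈ Finset.range K, 1 := by simp
      _ ≤ _ := Finset.sum_le_sum fun k _ => Nat.mul_pos hm (one_le_numExtreme hAs hS k)
  simp only [zero_add, List.length_singleton, Finset.sum_add_distrib, ← Finset.mul_sum]
    at h₁ h₂ h₃ hK' ⊢
  simp only [forwardDP, steps_bind, value_cons, steps_cons, steps_tick]
  generalize (mainLoop As K [⟨a, []⟩] : Prog ℤ ℝ (List (Node ℤ))).value f = E at *
  rcases E with _ | ⟨e, E⟩
  · exact absurd rfl h₁.ne_nil
  · have hp := h₁.path_length _ (value_findBest_mem (f := f) e (f (realPoint e)) E)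
    have hs := steps_findBest (f := f) e (f (realPoint e)) E
    simp only [steps_bind, steps_query, steps_reverseOnto]
    change _ + (_ + (_ + (_ + ((findBest e (f (realPoint e)) E).steps f +
      (2 * ((findBest e (f (realPoint e)) E).value f).path.length + 1))))) ≤ _
    rw [hp, hs]
    rw [List.length_cons] at h₂
    omega

end Loop

/-- The binary logarithm, rounded up, in terms of the natural logarithm. -/
theorem clog_le_three_mul_log {l : ℕ} (hl : 2 ≤ l) : (Nat.clog 2 l : ℝ) ≤ 3 * Real.log l := by
  have h2 := Real.log_two_gt_d9
  have hl' : (2 : ℝ) ≤ l := by exact_mod_cast hl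
  have hlog : Real.log 2 ≤ Real.log l := Real.log_le_log (by norm_num) hl'
  -- Hence `(clog - 1) log 2 ≤ log l`, and `log 2 ≤ log l` gives `clog ≤ 2 log l / log 2`; the
  -- factor 3 suffices as `log 2 > 2/3`.
  have hlt : (2 : ℝ) ^ (Nat.clog 2 l - 1) ≤ l := by
    exact_mod_cast (Nat.pow_pred_clog_lt_self (b := 2) (by norm_num) (x := l) (by omega)).le
  have h := Real.log_le_log (by positivity) hlt
  have hpos : 1 ≤ Nat.clog 2 l := Nat.clog_pos (by norm_num) hl
  rw [Real.log_pow, Nat.cast_sub hpos, Nat.cast_one] at h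
  have hc : (0 : ℝ) ≤ Nat.clog 2 l := Nat.cast_nonneg _
  nlinarith

end SwitchedSystem

theorem mainTheorem7 :
    ∃ C : ℝ, 0 < C ∧
      ∀ (m K : ℕ), 2 ≤ m → 1 ≤ K →
      ∀ (A : Fin m → Matrix (Fin 2) (Fin 2) ℤ) (a : Fin 2 → ℤ) (f : (Fin 2 → ℝ) → ℝ),
        ConvexOn ℝ Set.univ f →
        let S : Set (Matrix (Fin 2) (Fin 2) ℝ) :=
          Set.range fun i => (A i).map (fun z : ℤ => (z : ℝ))
        (((SwitchedSystem.forwardDP (List.ofFn A) a K).steps f : ℕ) : ℝ) ≤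
          C * ((m : ℝ) * Real.log m * ∑ k ∈ Finset.range K, (SwitchedSystem.numExtreme S k : ℝ) +
            (m : ℝ) * ∑ k ∈ Finset.range K,
              (SwitchedSystem.numExtreme S k : ℝ) * Real.log (SwitchedSystem.numExtreme S k : ℝ)) := by
  -- 243 = 31 · 3 + 150, where 75 ≤ 150 log(m N) because log(m N) ≥ log 2 > 1/2.
  refine ⟨243, by norm_num, fun m K hm hK A a f _ => ?_⟩
  intro S
  have hlen : (List.ofFn A).length = m := List.length_ofFn
  have hAs : List.ofFn A ≠ [] := List.ne_nil_of_length_pos (by omega)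
  have hS : ∀ T, T ∈ S ↔ ∃ B ∈ List.ofFn A, B.map (fun z : ℤ => (z : ℝ)) = T := by
    intro T
    simp [S, List.mem_ofFn]
  have h := SwitchedSystem.steps_forwardDP_le (f := f) hAs hS a hK
  rw [hlen] at h
  refine (Nat.cast_le.2 h).trans ?_
  rw [Nat.cast_sum, Finset.mul_sum, Finset.mul_sum, ← Finset.sum_add_distrib, Finset.mul_sum]
  refine Finset.sum_le_sum fun k _ => ?_
  have hN := SwitchedSystem.one_le_numExtreme hAs hS k
  generalize SwitchedSystem.numExtreme S k = N at hN ⊢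
  have hl : 2 ≤ m * N := hm.trans (Nat.le_mul_of_pos_right _ hN)
  have hc := SwitchedSystem.clog_le_three_mul_log hl
  have hl' : (2 : ℝ) ≤ (m * N : ℕ) := by exact_mod_cast hl
  have h2 := Real.log_two_gt_d9
  have hlog := Real.log_le_log (by norm_num) hl'
  have hm0 : (m : ℝ) ≠ 0 := by positivity
  have hN0 : (N : ℝ) ≠ 0 := by positivity
  have hexp : Real.log (m * N : ℕ) = Real.log m + Real.log N := by
    rw [Nat.cast_mul, Real.log_mul hm0 hN0]
  calc ((31 * (m * N * Nat.clog 2 (m * N)) + 75 * (m * N) : ℕ) : ℝ)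
      = (m * N : ℕ) * (31 * Nat.clog 2 (m * N) + 75) := by push_cast; ring
    _ ≤ (m * N : ℕ) * (243 * Real.log (m * N : ℕ)) :=
        mul_le_mul_of_nonneg_left (by linarith) (by positivity)
    _ = _ := by rw [hexp]; push_cast; ring
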